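/- Let $\Omega=(a,b)\times(c,d)$ with $a<b$, $c<d$, let $T>0$ and $0<\gamma<1$. Let $u$ be a solution of $$\frac{\partial u}{\partial t}(x,y,t)+\int_\Omega\frac{u(x,y,t)-u(\bar x,\bar y,t)}{|x-\bar x|^{\gamma}|y-\bar y|^{\gamma}}\,d\bar x\,d\bar y=f(x,y,t),\qquad (x,y,t)\in\Omega\times(0,T],$$ with $u=g$ on $\partial\Omega\times(0,T]$ and $u(\cdot,\cdot,0)=u_0$ in $\Omega$. Assume that $u(\cdot,\cdot,t)\in C^6([a,b]\times[c,d])$ with derivatives of order $\le 6$ bounded uniformly in $t\in[0,T]$, and $u(x,y,\cdot)\in C^3([0,T])$ with derivatives of order $\le 3$ bounded uniformly in $(x,y)\in[a,b]\times[c,d]$. For integers $M_x,M_y\ge1$ put $h_x=(b-a)/M_x$, $h_y=(d-c)/M_y$, $x_{i/2}=a+\tfrac i2h_x$ $(0\le i\le 2M_x)$, $y_{j/2}=c+\tfrac j2h_y$ $(0\le j\le 2M_y)$. Let $\phi_{l/2}$, $0\le l\le 2M_x$, be the continuous piecewise quadratic Lagrange basis on the cells $[x_{l-1},x_l]$, $1\le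 l\le M_x$, with nodes $x_{l/2}$ (so $\phi_{l/2}(x_{i/2})=\delta_{il}$); for the $y$-direction, also written $\phi_{r/2}$, likewise. For $1\le i\le 2M_x-1$ put $$d^x_i=\int_a^b\frac{d\bar x}{|x_{i/2}-\bar x|^\gamma},\qquad g^x_{i,l}=\int_a^b\frac{\phi_{l/2}(\bar x)}{|x_{i/2}-\bar x|^\gamma}\,d\bar x\quad(0\le l\le 2M_x),$$ and define $d^y_j,g^y_{j,r}$ in the same way on $[c,d]$. Let $\mathcal A=\mathcal D_x\otimes\mathcal D_y-\mathcal G_x\otimes\mathcal G_y$ with $\mathcal D_x=\mathrm{diag}(d^x_i)_{1\le i\le 2M_x-1}$, $\mathcal G_x=(g^x_{i,l})_{1\le i,l\le 2M_x-1}$, and similarly $\mathcal D_y,\mathcal G_y$. Let $\tau>0$, $N\ge0$ with $N\tau\le T$, $t_s=s\tau$. The Crank–Nicolson scheme is $$\Big(I+\frac\tau2\mathcal A\Big)U^k=\Big(I-\frac\tau2\mathcal A\Big)U^{k-1}+\tau F^{k-\frac12}+\tau K^{k-\frac12},\quad k=1,\dots,N,$$ for $U^k=(u^k_{i/2,j/2})_{1\le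 i\le 2M_x-1,\,1\le j\le 2M_y-1}$, with $u^0_{i/2,j/2}=u_0(x_{i/2},y_{j/2})$, $F^{k-1/2}_{i,j}=f(x_{i/2},y_{j/2},t_{k-1/2})$, and boundary data $$K^{k-\frac12}_{i,j}=\sum_{(l,r)}g^x_{i,l}\,g^y_{j,r}\,g(x_{l/2},y_{r/2},t_{k-\frac12}),$$ the sum being over all $0\le l\le 2M_x$, $0\le r\le 2M_y$ with $(x_{l/2},y_{r/2})\in\partial\Omega$. Then there is a constant $C$, independent of $M_x,M_y,N,\tau$, such that for all $M_x,M_y\ge 1$ and all $\tau>0$, $N\ge0$ with $N\tau\le T$ the scheme has a unique solution, and this solution satisfies $$\max_{1\le i\le 2M_x-1,\;1\le j\le 2M_y-1}\big|u(x_{i/2},y_{j/2},t_k)-u^k_{i/2,j/2}\big|\le C\big(\tau^2+h_x^{4-\gamma}+h_y^{4-\gamma}\big),\qquad k=0,1,\dots,N.$$ -/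

import Mathlib

open Set MeasureTheory
open scoped Kronecker

namespace NonlocalCN

/-- The step size `(b - a) / M` of the uniform partition of `[a, b]` into `M` cells. -/
noncomputable def step (a b : ℝ) (M : ℕ) : ℝ := (b - a) / M

/-- The point `x_s = a + s h`; it is used for integers and half-integers `s`. -/
noncomputable def node (a h s : ℝ) : ℝ := a + s * h

/-- The quadratic basis function attached to the cell end point `x_l` (`l` an integer). For `l = 0`
and `l = M`, only one of the two branches matters on `[a, b]`. -/
noncomputable def vertexBasis (a h l x : ℝ) : ℝ :=
  if node a h (l - 1) ≤ x ∧ x ≤ node a h l then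
    (x - node a h (l - 1)) / h * ((2 * x - (node a h l + node a h (l - 1))) / h)
  else if node a h l ≤ x ∧ x ≤ node a h (l + 1) then
    (node a h (l + 1) - x) / h * (((node a h (l + 1) + node a h l) - 2 * x) / h)
  else 0

/-- The quadratic basis function attached to the cell midpoint `x_s`, `s = l - 1/2`, of the cell
`[x_{l-1}, x_l] = [x_{s-1/2}, x_{s+1/2}]`. -/
noncomputable def midBasis (a h s x : ℝ) : ℝ :=
  if node a h (s - 1 / 2) ≤ x ∧ x ≤ node a h (s + 1 / 2) then
    4 * (x - node a h (s - 1 / 2)) * (node a h (s + 1 / 2) - x) / h ^ 2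
  else 0

/-- The basis function `φ_{i/2}`, `0 ≤ i ≤ 2M`. -/
noncomputable def basis (a h : ℝ) (i : ℕ) (x : ℝ) : ℝ :=
  if Even i then vertexBasis a h ((i : ℝ) / 2) x else midBasis a h ((i : ℝ) / 2) x

/-- `∫_a^b |x_{i/2} - x|^{-γ} dx`. -/
noncomputable def diagWeight (a b γ : ℝ) (M i : ℕ) : ℝ :=
  ∫ x in a..b, 1 / |node a (step a b M) ((i : ℝ) / 2) - x| ^ γ

/-- `∫_a^b φ_{l/2}(x) |x_{i/2} - x|^{-γ} dx`. -/
noncomputable def weight (a b γ : ℝ) (M i l : ℕ) : ℝ :=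
  ∫ x in a..b, basis a (step a b M) l x / |node a (step a b M) ((i : ℝ) / 2) - x| ^ γ

/-- The diagonal matrix `𝒟` of one space direction. The interior nodes `x_{i/2}`,
`i = 1, …, 2M - 1`, are indexed by `Fin (2 * M - 1)`, with `i` at position `i - 1`. -/
noncomputable def matD (a b γ : ℝ) (M : ℕ) : Matrix (Fin (2 * M - 1)) (Fin (2 * M - 1)) ℝ :=
  Matrix.diagonal fun i => diagWeight a b γ M ((i : ℕ) + 1)

/-- The matrix `𝒢` of one space direction. -/
noncomputable def matG (a b γ : ℝ) (M : ℕ) : Matrix (Fin (2 * M - 1)) (Fin (2 * M - 1)) ℝ :=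
  Matrix.of fun i l => weight a b γ M ((i : ℕ) + 1) ((l : ℕ) + 1)

/-- The indices of the interior nodes of the two-dimensional grid. -/
abbrev Grid (Mx My : ℕ) : Type := Fin (2 * Mx - 1) × Fin (2 * My - 1)

/-- `𝒜 = 𝒟_x ⊗ 𝒟_y - 𝒢_x ⊗ 𝒢_y`. -/
noncomputable def matA (a b c d γ : ℝ) (Mx My : ℕ) : Matrix (Grid Mx My) (Grid Mx My) ℝ :=
  matD a b γ Mx ⊗ₖ matD c d γ My - matG a b γ Mx ⊗ₖ matG c d γ My

/-- The values `v(x_{i/2}, y_{j/2})` of a function of two variables at the interior nodes. -/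
noncomputable def sample (a b c d : ℝ) (Mx My : ℕ) (v : ℝ → ℝ → ℝ) : Grid Mx My → ℝ := fun p =>
  v (node a (step a b Mx) ((((p.1 : ℕ) + 1 : ℕ) : ℝ) / 2))
    (node c (step c d My) ((((p.2 : ℕ) + 1 : ℕ) : ℝ) / 2))

/-- The boundary vector `K`, for boundary values given by `g`. -/
noncomputable def bdryVec (a b c d γ : ℝ) (Mx My : ℕ) (g : ℝ → ℝ → ℝ) : Grid Mx My → ℝ := fun p =>
  let X : ℕ → ℝ := fun l => node a (step a b Mx) ((l : ℝ) / 2)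
  let Y : ℕ → ℝ := fun r => node c (step c d My) ((r : ℝ) / 2)
  let wx : ℕ → ℝ := fun l => weight a b γ Mx ((p.1 : ℕ) + 1) l
  let wy : ℕ → ℝ := fun r => weight c d γ My ((p.2 : ℕ) + 1) r
  wx 0 * ∑ r ∈ Finset.Icc 0 (2 * My), wy r * g (X 0) (Y r)
    + wx (2 * Mx) * ∑ r ∈ Finset.Icc 0 (2 * My), wy r * g (X (2 * Mx)) (Y r)
    + ∑ l ∈ Finset.Icc 1 (2 * Mx - 1), wx l * wy 0 * g (X l) (Y 0)
    + ∑ l ∈ Finset.Icc 1 (2 * Mx - 1), wx l * wy (2 * My) * g (X l) (Y (2 * My))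

/-- `U 0, …, U N` solve the Crank–Nicolson collocation scheme with time step `τ`, source `f`,
boundary values `g` and initial values `u₀`. The step from `U k` to `U (k + 1)` takes the source and
the boundary values at time `t_{k+1/2} = (k + 1/2) τ`. -/
def IsSchemeSolution (a b c d γ τ : ℝ) (Mx My N : ℕ) (f g : ℝ → ℝ → ℝ → ℝ) (u₀ : ℝ → ℝ → ℝ)
    (U : Fin (N + 1) → Grid Mx My → ℝ) : Prop :=
  U 0 = sample a b c d Mx My u₀ ∧
  ∀ k : Fin N,
    (1 + (τ / 2) • matA a b c d γ Mx My).mulVec (U k.succ) =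
      (1 - (τ / 2) • matA a b c d γ Mx My).mulVec (U k.castSucc)
        + τ • sample a b c d Mx My (fun x y => f x y ((((k : ℕ) : ℝ) + 1 / 2) * τ))
        + τ • bdryVec a b c d γ Mx My (fun x y => g x y ((((k : ℕ) : ℝ) + 1 / 2) * τ))

/-- The nonlocal operator with kernel `|x - x̄|^{-γ} |y - ȳ|^{-γ}` on `(a, b) × (c, d)`. -/
noncomputable def nonlocalOp (a b c d γ : ℝ) (v : ℝ → ℝ → ℝ) (x y : ℝ) : ℝ :=
  ∫ p in Ioo a b ×ˢ Ioo c d, (v x y - v p.1 p.2) / (|x - p.1| ^ γ * |y - p.2| ^ γ)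

/-- `u` solves `∂ₜu + (nonlocal operator) u = f` in `Ω × (0, T]`, `Ω = (a, b) × (c, d)`, with
Dirichlet boundary values `g` and initial values `u₀`. The time derivative at `t = T` is one-sided. -/
def IsExactSolution (a b c d T γ : ℝ) (f g : ℝ → ℝ → ℝ → ℝ) (u₀ : ℝ → ℝ → ℝ)
    (u : ℝ → ℝ → ℝ → ℝ) : Prop :=
  (∀ x ∈ Ioo a b, ∀ y ∈ Ioo c d, ∀ t ∈ Ioc 0 T,
    HasDerivWithinAt (fun s => u x y s)
      (f x y t - nonlocalOp a b c d γ (fun x' y' => u x' y' t) x y) (Icc 0 T) t) ∧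
  (∀ p ∈ (Icc a b ×ˢ Icc c d) \ (Ioo a b ×ˢ Ioo c d), ∀ t ∈ Ioc 0 T,
    u p.1 p.2 t = g p.1 p.2 t) ∧
  (∀ x ∈ Ioo a b, ∀ y ∈ Ioo c d, u x y 0 = u₀ x y)

/-- `u(·, ·, t) ∈ C⁶([a, b] × [c, d])` with derivatives of order at most six bounded uniformly in
`t ∈ [0, T]`, and `u(x, y, ·) ∈ C³([0, T])` with derivatives of order at most three bounded
uniformly in `(x, y) ∈ [a, b] × [c, d]`. -/
def IsSmooth (a b c d T : ℝ) (u : ℝ → ℝ → ℝ → ℝ) : Prop :=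
  (∀ t ∈ Icc 0 T, ContDiffOn ℝ 6 (fun p : ℝ × ℝ => u p.1 p.2 t) (Icc a b ×ˢ Icc c d)) ∧
  (∃ B : ℝ, ∀ t ∈ Icc 0 T, ∀ p ∈ Icc a b ×ˢ Icc c d, ∀ m : ℕ, m ≤ 6 →
    ‖iteratedFDerivWithin ℝ m (fun q : ℝ × ℝ => u q.1 q.2 t) (Icc a b ×ˢ Icc c d) p‖ ≤ B) ∧
  (∀ p ∈ Icc a b ×ˢ Icc c d, ContDiffOn ℝ 3 (fun t => u p.1 p.2 t) (Icc 0 T)) ∧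
  (∃ B : ℝ, ∀ p ∈ Icc a b ×ˢ Icc c d, ∀ t ∈ Icc 0 T, ∀ m : ℕ, m ≤ 3 →
    |iteratedDerivWithin m (fun s => u p.1 p.2 s) (Icc 0 T) t| ≤ B)

end NonlocalCN

/-! The argument is consistency plus stability in the maximum norm.

Stability. The product weights are nonnegative (`weight_nonneg`) and, boundary nodes included, each
row sums to the diagonal entry (`sum_weight`), so `matA` is weakly diagonally dominant. Looking at
an entry of largest modulus gives `‖s‖ ≤ ‖(I + τ/2 A) s‖`, hence unique solvability. The explicit
factor need not be a contraction: since the kernel is integrable, `‖A‖ ≤ 2K` with `K` independent of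
the mesh, so each step amplifies the error by at most `1 + τK`, and a discrete Grönwall inequality
yields the factor `T exp(TK)`.

Consistency in time is Taylor expansion about the left end of the time step. In space, the decisive
point is the one-dimensional rate `h^(4-γ)` (`abs_quadrature_error_le`). On each cell the
interpolation error is a constant times the cubic nodal polynomial plus `O(h⁴)`. The cubic is odd
about the midpoint of the cell, so its integral against the kernel is at most `h³` times the
difference of the kernel masses of the two half-cells. The singularity is a point of the half-step
grid, and the kernel decreases away from it on both sides; these differences therefore telescope, to
at most twice the largest half-cell mass, which is of order `h^(1-γ)`. Tensorization costs only the
bounded kernel masses, again because the weights are nonnegative. -/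

namespace NonlocalCN

/-! ### The weakly singular kernel and its integrals -/

/-- The weakly singular kernel `|X - x|^{-γ}`. -/
noncomputable def kern (γ X x : ℝ) : ℝ := 1 / |X - x| ^ γ

lemma kern_nonneg (γ X x : ℝ) : 0 ≤ kern γ X x := by
  unfold kern; positivity

/-- Every estimate to the left of the singularity is reduced by this symmetry to one on its right.
-/
lemma kern_reflect (γ s X x : ℝ) : kern γ (s - X) (s - x) = kern γ X x := by
  unfold kern
  rw [show s - X - (s - x) = -(X - x) by ring, abs_neg]

lemma kern_add (γ s X x : ℝ) : kern γ (X + s) (x + s) = kern γ X x := by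
  unfold kern
  rw [show X + s - (x + s) = X - x by ring]

/-- The point `x = X` is included: for `γ ≠ 0` both sides take the default value `0` there.
Monotonicity consequently needs the strict inequality `X < x`. -/
lemma kern_of_le {γ X x : ℝ} (h : X ≤ x) : kern γ X x = (x - X) ^ (-γ) := by
  unfold kern
  rw [abs_sub_comm, abs_of_nonneg (sub_nonneg.2 h), Real.rpow_neg (sub_nonneg.2 h), one_div]

/-- The kernel decreases to the right of the singularity. -/
lemma kern_anti {γ X x x' : ℝ} (hγ : 0 < γ) (h : X < x) (h' : x ≤ x') :
    kern γ X x' ≤ kern γ X x := by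
  rw [kern_of_le h.le, kern_of_le (h.le.trans h')]
  exact Real.rpow_le_rpow_of_nonpos (sub_pos.2 h) (by linarith) (by linarith)

lemma intervalIntegrable_kern_right {γ : ℝ} (hγ : γ < 1) {X q : ℝ} (h : X ≤ q) :
    IntervalIntegrable (kern γ X) volume X q := by
  have h1 : IntervalIntegrable (fun x : ℝ => x ^ (-γ)) volume 0 (q - X) :=
    intervalIntegral.intervalIntegrable_rpow' (by linarith)
  have h2 := h1.comp_sub_right X
  simp only [zero_add, sub_add_cancel] at h2
  refine h2.congr fun x hx => ?_
  rw [uIoc_of_le h] at hx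
  exact (kern_of_le hx.1.le).symm

lemma intervalIntegrable_kern {γ : ℝ} (hγ : γ < 1) (X p q : ℝ) :
    IntervalIntegrable (kern γ X) volume p q := by
  have key : ∀ q, IntervalIntegrable (kern γ X) volume X q := by
    intro q
    rcases le_total X q with h | h
    · exact intervalIntegrable_kern_right hγ h
    · have h1 : IntervalIntegrable (kern γ X) volume X (2 * X - q) :=
        intervalIntegrable_kern_right hγ (by linarith)
      have h2 := h1.comp_sub_left (2 * X)
      rw [show 2 * X - X = X by ring, show 2 * X - (2 * X - q) = q by ring] at h2
      refine h2.congr fun x _ => ?_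
      have := kern_reflect γ (2 * X) X x
      rwa [show 2 * X - X = X by ring] at this
  exact (key p).symm.trans (key q)

lemma integral_kern_right {γ : ℝ} (hγ : γ < 1) (X : ℝ) {s : ℝ} (hs : 0 ≤ s) :
    ∫ x in X..X + s, kern γ X x = s ^ (1 - γ) / (1 - γ) := by
  have h1 : ∫ x in X..X + s, kern γ X x = ∫ x in X..X + s, (fun y => y ^ (-γ)) (x - X) := by
    refine intervalIntegral.integral_congr fun x hx => ?_
    rw [uIcc_of_le (by linarith)] at hx
    exact kern_of_le hx.1
  rw [h1, intervalIntegral.integral_comp_sub_right (fun y => y ^ (-γ)), sub_self,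
    add_sub_cancel_left, integral_rpow (Or.inl (by linarith)), Real.zero_rpow (by linarith)]
  rw [show -γ + 1 = 1 - γ by ring, sub_zero]

lemma integral_kern_reflect (γ X p q s : ℝ) :
    ∫ x in p..q, kern γ X x = ∫ x in s - q..s - p, kern γ (s - X) x := by
  rw [← intervalIntegral.integral_comp_sub_left (kern γ (s - X))]
  simp only [kern_reflect]

lemma integral_kern_left {γ : ℝ} (hγ : γ < 1) (X : ℝ) {s : ℝ} (hs : 0 ≤ s) :
    ∫ x in X - s..X, kern γ X x = s ^ (1 - γ) / (1 - γ) := by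
  rw [integral_kern_reflect γ X _ _ (2 * X), ← integral_kern_right hγ X hs]
  congr 1 <;> ring_nf

lemma integral_kern_mono {γ : ℝ} (hγ : γ < 1) (X : ℝ) {p q p' q' : ℝ} (h1 : p' ≤ p) (h2 : p ≤ q)
    (h3 : q ≤ q') : ∫ x in p..q, kern γ X x ≤ ∫ x in p'..q', kern γ X x :=
  intervalIntegral.integral_mono_interval h1 h2 h3
    (Filter.Eventually.of_forall fun x => kern_nonneg γ X x) (intervalIntegrable_kern hγ X _ _)

/-- The bound for the row sums of the one-dimensional weights. -/
noncomputable def kernBound (a b γ : ℝ) : ℝ := 2 * ((b - a) ^ (1 - γ) / (1 - γ))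

lemma kernBound_nonneg {a b γ : ℝ} (hab : a ≤ b) (hγ : γ < 1) : 0 ≤ kernBound a b γ := by
  have h1 : 0 ≤ b - a := by linarith
  have h2 : 0 ≤ 1 - γ := by linarith
  unfold kernBound
  positivity

/-- The interval `[X - (b - a), X + (b - a)]` contains `[a, b]`, and its kernel mass is exactly
`kernBound`, whatever the position of `X`. -/
lemma integral_kern_le {a b γ X : ℝ} (hγ : γ < 1) (ha : a ≤ X) (hb : X ≤ b) :
    ∫ x in a..b, kern γ X x ≤ kernBound a b γ := by
  have h0 : 0 ≤ b - a := by linarith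
  have h1 := integral_kern_mono (γ := γ) hγ X (p := a) (q := b) (p' := X - (b - a))
    (q' := X + (b - a)) (by linarith) (by linarith) (by linarith)
  rw [← intervalIntegral.integral_add_adjacent_intervals
    (intervalIntegrable_kern hγ X (X - (b - a)) X) (intervalIntegrable_kern hγ X X _),
    integral_kern_left hγ X h0, integral_kern_right hγ X h0] at h1
  unfold kernBound
  linarith

/-! ### Cancellation of the nodal cubic against the kernel -/

/-- The cubic polynomial vanishing at the two end points and the midpoint of `[p, p + h]`. -/
noncomputable def nodal (p h x : ℝ) : ℝ := (x - p) * (x - (p + h / 2)) * (x - (p + h))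

lemma continuous_nodal (p h : ℝ) : Continuous (nodal p h) := by unfold nodal; fun_prop

lemma abs_nodal_le {p h x : ℝ} (hx : x ∈ Icc p (p + h)) : |nodal p h x| ≤ h ^ 3 := by
  have h1 : |x - p| ≤ h := abs_le.2 ⟨by linarith [hx.1, hx.2], by linarith [hx.2]⟩
  have h2 : |x - (p + h / 2)| ≤ h := abs_le.2 ⟨by linarith [hx.1, hx.2], by linarith [hx.1, hx.2]⟩
  have h3 : |x - (p + h)| ≤ h := abs_le.2 ⟨by linarith [hx.1], by linarith [hx.1, hx.2]⟩
  have h0 : 0 ≤ h := (abs_nonneg _).trans h1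
  unfold nodal
  rw [abs_mul, abs_mul]
  calc _ ≤ h * h * h := by gcongr
    _ = h ^ 3 := by ring

lemma nodal_reflect (p h x : ℝ) : nodal p h (2 * p + h - x) = -nodal p h x := by
  unfold nodal; ring

/-- An integral that is odd with respect to the midpoint of the interval vanishes. -/
lemma integral_eq_zero_of_odd {f : ℝ → ℝ} {p q : ℝ} (hf : ∀ x, f (p + q - x) = -f x) :
    ∫ x in p..q, f x = 0 := by
  have h1 := intervalIntegral.integral_comp_sub_left (a := p) (b := q) f (p + q)
  simp only [hf, add_sub_cancel_right, add_sub_cancel_left, intervalIntegral.integral_neg] at h1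
  linarith

lemma integral_nodal (p h : ℝ) : ∫ x in p..p + h, nodal p h x = 0 := by
  refine integral_eq_zero_of_odd fun x => ?_
  rw [← nodal_reflect]; ring_nf

lemma abs_integral_le_of_abs_le {f g : ℝ → ℝ} {p q : ℝ} (hpq : p ≤ q)
    (hg : IntervalIntegrable g volume p q) (h : ∀ x ∈ Ioc p q, |f x| ≤ g x) :
    |∫ x in p..q, f x| ≤ ∫ x in p..q, g x := by
  rw [← Real.norm_eq_abs]
  exact intervalIntegral.norm_integral_le_of_norm_le hpq (Filter.Eventually.of_forall h) hg

/-- The nodal cubic has mean zero, so the midpoint value `km` may be subtracted from the kernel. By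
monotonicity the difference is nonnegative on the left half and nonpositive on the right half;
bounding the cubic by `h ^ 3` leaves the two masses, and the `km` terms cancel because the halves
have equal length. -/
lemma abs_integral_nodal_kern_right {γ X p h : ℝ} (hγ₀ : 0 < γ) (hγ : γ < 1) (hh : 0 < h)
    (hX : X ≤ p) :
    |∫ x in p..p + h, nodal p h x * kern γ X x| ≤
      h ^ 3 * ((∫ x in p..p + h / 2, kern γ X x) - ∫ x in p + h / 2..p + h, kern γ X x) := by
  set km := kern γ X (p + h / 2) with hkm
  have hI := intervalIntegrable_kern hγ X
  have hI' : ∀ s t, IntervalIntegrable (fun x => kern γ X x - km) volume s t := fun s t =>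
    (hI s t).sub intervalIntegrable_const
  have hN : ∀ s t, IntervalIntegrable (fun x => nodal p h x * (kern γ X x - km)) volume s t :=
    fun s t => (hI' s t).continuousOn_mul (continuous_nodal p h).continuousOn
  have e1 : ∫ x in p..p + h, nodal p h x * kern γ X x =
      ∫ x in p..p + h, nodal p h x * (kern γ X x - km) := by
    have : ∀ x, nodal p h x * (kern γ X x - km) = nodal p h x * kern γ X x - nodal p h x * km :=
      fun x => by ring
    simp only [this]
    rw [intervalIntegral.integral_sub
      ((hI p (p + h)).continuousOn_mul (continuous_nodal p h).continuousOn)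
      (((continuous_nodal p h).intervalIntegrable _ _).mul_const _),
      intervalIntegral.integral_mul_const, integral_nodal]
    simp
  have b1 : |∫ x in p..p + h / 2, nodal p h x * (kern γ X x - km)| ≤
      ∫ x in p..p + h / 2, h ^ 3 * (kern γ X x - km) := by
    refine abs_integral_le_of_abs_le (by linarith) ((hI' _ _).const_mul _) fun x hx => ?_
    rw [abs_mul,
      abs_of_nonneg (sub_nonneg.2 (kern_anti hγ₀ (hX.trans_lt hx.1) hx.2))]
    exact mul_le_mul_of_nonneg_right (abs_nodal_le ⟨hx.1.le, by linarith [hx.2]⟩)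
      (sub_nonneg.2 (kern_anti hγ₀ (hX.trans_lt hx.1) hx.2))
  have b2 : |∫ x in p + h / 2..p + h, nodal p h x * (kern γ X x - km)| ≤
      ∫ x in p + h / 2..p + h, h ^ 3 * (-(kern γ X x - km)) := by
    refine abs_integral_le_of_abs_le (by linarith) ((hI' _ _).neg.const_mul _) fun x hx => ?_
    have hk : kern γ X x ≤ km := kern_anti hγ₀ (by linarith) hx.1.le
    rw [abs_mul, abs_of_nonpos (by linarith : kern γ X x - km ≤ 0)]
    exact mul_le_mul_of_nonneg_right (abs_nodal_le ⟨by linarith [hx.1], hx.2⟩) (by linarith)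
  rw [e1, ← intervalIntegral.integral_add_adjacent_intervals (hN p (p + h / 2))
    (hN (p + h / 2) (p + h))]
  refine (abs_add_le _ _).trans ((add_le_add b1 b2).trans_eq ?_)
  rw [intervalIntegral.integral_const_mul, intervalIntegral.integral_const_mul,
    intervalIntegral.integral_neg, intervalIntegral.integral_sub (hI _ _) intervalIntegrable_const,
    intervalIntegral.integral_sub (hI _ _) intervalIntegrable_const]
  simp only [intervalIntegral.integral_const, smul_eq_mul]
  ring

/-- The kernel is folded about the midpoint of a cell: the integral against the odd nodal
polynomial only sees the difference of the masses of the kernel on the two halves of the cell. -/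
lemma abs_integral_nodal_kern {γ X p h : ℝ} (hγ₀ : 0 < γ) (hγ : γ < 1) (hh : 0 < h)
    (hX : X ≤ p ∨ X = p + h / 2 ∨ p + h ≤ X) :
    |∫ x in p..p + h, nodal p h x * kern γ X x| ≤
      h ^ 3 * |(∫ x in p..p + h / 2, kern γ X x) - ∫ x in p + h / 2..p + h, kern γ X x| := by
  rcases hX with hX | hX | hX
  · exact (abs_integral_nodal_kern_right hγ₀ hγ hh hX).trans
      (mul_le_mul_of_nonneg_left (le_abs_self _) (by positivity))
  -- With the singularity at the midpoint the kernel is even about it and the integrand is odd.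
  · rw [integral_eq_zero_of_odd, abs_zero]
    · positivity
    · intro x
      have := kern_reflect γ (p + (p + h)) X x
      rw [show p + (p + h) - X = X by rw [hX]; ring] at this
      rw [this, show p + (p + h) - x = 2 * p + h - x by ring, nodal_reflect, neg_mul]
  -- Reflection about the midpoint of the cell puts the singularity on the left, flips the sign of
  -- the cubic and exchanges the half-cells.
  · have e : ∫ x in p..p + h, nodal p h x * kern γ X x =
        -∫ x in p..p + h, nodal p h x * kern γ (2 * p + h - X) x := by
      have := intervalIntegral.integral_comp_sub_left (a := p) (b := p + h)
        (fun x => nodal p h x * kern γ (2 * p + h - X) x) (2 * p + h)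
      simp only [kern_reflect, nodal_reflect, neg_mul, intervalIntegral.integral_neg] at this
      rw [show 2 * p + h - (p + h) = p by ring, show 2 * p + h - p = p + h by ring] at this
      rw [← this, neg_neg]
    have key := abs_integral_nodal_kern_right (X := 2 * p + h - X) (p := p) hγ₀ hγ hh (by linarith)
    rw [e, abs_neg, abs_sub_comm, integral_kern_reflect γ X p _ (2 * p + h),
      integral_kern_reflect γ X (p + h / 2) _ (2 * p + h),
      show 2 * p + h - (p + h) = p by ring, show 2 * p + h - p = p + h by ring,
      show 2 * p + h - (p + h / 2) = p + h / 2 by ring]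
    exact key.trans (mul_le_mul_of_nonneg_left (le_abs_self _) (by positivity))

/-! ### Kernel masses on a uniform grid and their total variation -/

/-- The mass of the kernel on the `n`-th interval of length `δ` to the right of its singularity. -/
noncomputable def shellMass (γ δ : ℝ) (n : ℕ) : ℝ := ∫ x in n * δ..(n + 1) * δ, kern γ 0 x

lemma shellMass_zero {γ δ : ℝ} (hγ : γ < 1) (hδ : 0 ≤ δ) :
    shellMass γ δ 0 = δ ^ (1 - γ) / (1 - γ) := by
  have := integral_kern_right hγ 0 hδ
  simpa [shellMass] using this

lemma shellMass_nonneg (γ : ℝ) {δ : ℝ} (hδ : 0 ≤ δ) (n : ℕ) : 0 ≤ shellMass γ δ n :=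
  intervalIntegral.integral_nonneg (by nlinarith) fun x _ => kern_nonneg γ 0 x

lemma shellMass_antitone {γ δ : ℝ} (hγ₀ : 0 < γ) (hγ : γ < 1) (hδ : 0 < δ) :
    Antitone (shellMass γ δ) := by
  refine antitone_nat_of_succ_le fun n => ?_
  unfold shellMass
  have e : ∫ x in ((n + 1 : ℕ) : ℝ) * δ..(((n + 1 : ℕ) : ℝ) + 1) * δ, kern γ 0 x =
      ∫ x in n * δ..(n + 1) * δ, kern γ 0 (x + δ) := by
    rw [intervalIntegral.integral_comp_add_right (kern γ 0)]
    push_cast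
    congr 1 <;> ring
  rw [e]
  have hle : (n : ℝ) * δ ≤ (n + 1) * δ := by nlinarith
  have hI : IntervalIntegrable (fun x => kern γ 0 (x + δ)) volume (n * δ) ((n + 1) * δ) := by
    have := (intervalIntegrable_kern hγ 0 (n * δ + δ) ((n + 1) * δ + δ)).comp_add_right δ
    simpa using this
  -- The comparison is made on the open interval: for `n = 0` the left end is the singularity, where
  -- the kernel has the value `0`.
  refine intervalIntegral.integral_mono_on_of_le_Ioo hle hI (intervalIntegrable_kern hγ 0 _ _)
    fun x hx => ?_
  have : (0 : ℝ) ≤ n * δ := by positivity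
  exact kern_anti hγ₀ (by linarith [hx.1]) (by linarith)

/-- The mass of the kernel with singularity at the `i`-th point `p + i δ` of a grid on the `n`-th
interval of that grid. -/
noncomputable def gridMass (γ p δ : ℝ) (i n : ℕ) : ℝ :=
  ∫ x in p + n * δ..p + (n + 1) * δ, kern γ (p + i * δ) x

lemma gridMass_of_le (γ p δ : ℝ) {i n : ℕ} (h : i ≤ n) :
    gridMass γ p δ i n = shellMass γ δ (n - i) := by
  unfold gridMass shellMass
  have := intervalIntegral.integral_comp_add_right (a := ((n - i : ℕ) : ℝ) * δ)
    (b := (((n - i : ℕ) : ℝ) + 1) * δ) (kern γ (p + i * δ)) (p + i * δ)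
  have hk : ∀ x, kern γ (p + i * δ) (x + (p + i * δ)) = kern γ 0 x := fun x => by
    have := kern_add γ (p + i * δ) 0 x
    rwa [zero_add] at this
  simp only [hk] at this
  rw [this, Nat.cast_sub h]
  congr 1 <;> ring

/-- To the left of the singularity the nearer end of interval `n` is point `n + 1`, at distance `(i
- (n + 1)) δ`; hence the shift by one relative to the right side. -/
lemma gridMass_of_lt (γ p δ : ℝ) {i n : ℕ} (h : n < i) :
    gridMass γ p δ i n = shellMass γ δ (i - 1 - n) := by
  unfold gridMass shellMass
  rw [integral_kern_reflect γ _ _ _ (p + i * δ), sub_self]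
  rw [show i - 1 - n = i - (n + 1) by omega, Nat.cast_sub h]
  push_cast
  congr 1 <;> ring

/-- The masses of neighbouring grid intervals differ little in total, because they increase up to
the singularity and decrease afterwards. -/
lemma sum_abs_gridMass_sub_le {γ p δ : ℝ} (hγ₀ : 0 < γ) (hγ : γ < 1) (hδ : 0 < δ) (i M : ℕ) :
    ∑ l ∈ Finset.range M, |gridMass γ p δ i (2 * l) - gridMass γ p δ i (2 * l + 1)| ≤
      2 * shellMass γ δ 0 := by
  have hanti := shellMass_antitone hγ₀ hγ hδ
  have hnn := shellMass_nonneg γ hδ.le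
  -- A potential for the variation: the mass itself before the peak, and its mirror image in the
  -- level `shellMass γ δ 0` after it. It is increasing, stays in `[0, 2 * shellMass γ δ 0]`, and
  -- its increments dominate the jumps. The two intervals touching the singularity have equal mass,
  -- so nothing is lost there.
  let P : ℕ → ℝ := fun n =>
    if n < i then shellMass γ δ (i - 1 - n) else 2 * shellMass γ δ 0 - shellMass γ δ (n - i)
  have hstep : ∀ n, |gridMass γ p δ i n - gridMass γ p δ i (n + 1)| ≤ P (n + 1) - P n := by
    intro n
    rcases lt_trichotomy (n + 1) i with h | h | h
    · have hn : n < i := by omega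
      have := hanti (show i - 1 - (n + 1) ≤ i - 1 - n by omega)
      simp only [P, if_pos h, if_pos hn, gridMass_of_lt γ p δ h, gridMass_of_lt γ p δ hn]
      rw [abs_of_nonpos (by linarith)]
      linarith
    · have hn : n < i := by omega
      have e1 : i - 1 - n = 0 := by omega
      have e2 : n + 1 - i = 0 := by omega
      simp only [P, if_neg (show ¬ n + 1 < i by omega), if_pos hn, gridMass_of_lt γ p δ hn,
        gridMass_of_le γ p δ h.ge, e1, e2, sub_self, abs_zero]
      linarith
    · have hn : i ≤ n := by omega
      have := hanti (show n - i ≤ n + 1 - i by omega)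
      simp only [P, if_neg (show ¬ n + 1 < i by omega), if_neg (show ¬ n < i by omega),
        gridMass_of_le γ p δ hn, gridMass_of_le γ p δ (show i ≤ n + 1 by omega)]
      rw [abs_of_nonneg (by linarith)]
      linarith
  have hmono : ∀ n, P n ≤ P (n + 1) := fun n => by
    linarith [hstep n, abs_nonneg (gridMass γ p δ i n - gridMass γ p δ i (n + 1))]
  have hP0 : ∀ n, 0 ≤ P n := by
    intro n
    simp only [P]
    split_ifs
    · exact hnn _
    · linarith [hanti (Nat.zero_le (n - i)), hnn 0]
  have hP1 : ∀ n, P n ≤ 2 * shellMass γ δ 0 := by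
    intro n
    simp only [P]
    split_ifs
    · linarith [hanti (Nat.zero_le (i - 1 - n)), hnn 0]
    · linarith [hnn (n - i)]
  -- Only jumps inside a pair occur in the sum; the increments between pairs are nonnegative and are
  -- added to make it telescope.
  calc _ ≤ ∑ l ∈ Finset.range M, (P (2 * (l + 1)) - P (2 * l)) := by
        refine Finset.sum_le_sum fun l _ => (hstep (2 * l)).trans ?_
        have := hmono (2 * l + 1)
        rw [show 2 * (l + 1) = 2 * l + 1 + 1 by ring]
        linarith
    _ = P (2 * M) - P (2 * 0) := Finset.sum_range_sub (fun l => P (2 * l)) M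
    _ ≤ _ := by linarith [hP0 (2 * 0), hP1 (2 * M)]

/-! ### Quadratic shape functions and the sign of their kernel integrals -/

/-- The quadratic Lagrange basis on `[p, p + h]`: left end point. -/
noncomputable def shapeL (p h x : ℝ) : ℝ := (p + h - x) * (2 * p + h - 2 * x) / h ^ 2

/-- The quadratic Lagrange basis on `[p, p + h]`: midpoint. -/
noncomputable def shapeM (p h x : ℝ) : ℝ := 4 * (x - p) * (p + h - x) / h ^ 2

/-- The quadratic Lagrange basis on `[p, p + h]`: right end point. -/
noncomputable def shapeR (p h x : ℝ) : ℝ := (x - p) * (2 * x - 2 * p - h) / h ^ 2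

lemma continuous_shapeL (p h : ℝ) : Continuous (shapeL p h) := by unfold shapeL; fun_prop

lemma continuous_shapeM (p h : ℝ) : Continuous (shapeM p h) := by unfold shapeM; fun_prop

lemma continuous_shapeR (p h : ℝ) : Continuous (shapeR p h) := by unfold shapeR; fun_prop

lemma shape_sum {h : ℝ} (hh : h ≠ 0) (p x : ℝ) :
    shapeL p h x + shapeM p h x + shapeR p h x = 1 := by
  unfold shapeL shapeM shapeR; field_simp; ring

lemma shapeL_reflect (p h x : ℝ) : shapeL p h (2 * p + h - x) = shapeR p h x := by
  unfold shapeL shapeR; ring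

lemma abs_shapeR_le {p h x : ℝ} (hh : 0 < h) (hx : x ∈ Icc p (p + h)) : |shapeR p h x| ≤ 1 := by
  unfold shapeR
  rw [abs_div, abs_mul, abs_of_nonneg (by positivity : 0 ≤ h ^ 2), div_le_one (by positivity)]
  have h1 : |x - p| ≤ h := abs_le.2 ⟨by linarith [hx.1], by linarith [hx.2]⟩
  have h2 : |2 * x - 2 * p - h| ≤ h := abs_le.2 ⟨by linarith [hx.1], by linarith [hx.2]⟩
  calc _ ≤ h * h := by gcongr
    _ = h ^ 2 := by ring

lemma abs_shapeL_le {p h x : ℝ} (hh : 0 < h) (hx : x ∈ Icc p (p + h)) : |shapeL p h x| ≤ 1 := by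
  have := abs_shapeR_le (p := p) (x := 2 * p + h - x) hh ⟨by linarith [hx.2], by linarith [hx.1]⟩
  rwa [← shapeL_reflect, sub_sub_cancel] at this

lemma shapeM_nonneg {p h x : ℝ} (hx : x ∈ Icc p (p + h)) : 0 ≤ shapeM p h x := by
  have h1 : 0 ≤ x - p := by linarith [hx.1]
  have h2 : 0 ≤ p + h - x := by linarith [hx.2]
  unfold shapeM; positivity

lemma abs_shapeM_le {p h x : ℝ} (hh : 0 < h) (hx : x ∈ Icc p (p + h)) : |shapeM p h x| ≤ 1 := by
  rw [abs_of_nonneg (shapeM_nonneg hx)]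
  unfold shapeM
  rw [div_le_one (by positivity)]
  nlinarith [sq_nonneg (2 * x - 2 * p - h)]

/-- `(x - p) |X - x|^{-γ}` increases on an interval `[p, p + h]` that does not contain `X` in its
interior. -/
lemma sub_mul_kern_mono {γ X p h x y : ℝ} (hγ₀ : 0 < γ) (hγ : γ < 1)
    (hX : X ≤ p ∨ p + h ≤ X) (hx : p < x) (hxy : x ≤ y) (hy : y < p + h) :
    (x - p) * kern γ X x ≤ (y - p) * kern γ X y := by
  rcases hX with hX | hX
  · rw [kern_of_le (by linarith), kern_of_le (by linarith)]
    -- Both factors increase in `z`: the first because `γ < 1`, the quotient because `X ≤ p`.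
    have key : ∀ z, p < z →
        (z - p) * (z - X) ^ (-γ) = (z - p) ^ (1 - γ) * ((z - p) / (z - X)) ^ γ := by
      intro z hz
      have h1 : 0 < z - p := by linarith
      have h2 : 0 < z - X := by linarith
      rw [Real.div_rpow h1.le h2.le, Real.rpow_neg h2.le, Real.rpow_sub h1, Real.rpow_one]
      have := (Real.rpow_pos_of_pos h1 γ).ne'
      field_simp
    rw [key x hx, key y (by linarith)]
    have h1 : 0 < x - p := by linarith
    have h2 : 0 < x - X := by linarith
    have h3 : 0 < y - X := by linarith
    have hq : (x - p) / (x - X) ≤ (y - p) / (y - X) := by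
      rw [div_le_div_iff₀ h2 h3]
      nlinarith
    have hγ' : 0 ≤ 1 - γ := by linarith
    have h4 : 0 ≤ y - p := by linarith
    gcongr
  -- To the left of the singularity the kernel itself increases, as does `x - p`.
  · have := kern_anti (X := -X) (x := -y) (x' := -x) hγ₀ (by linarith) (by linarith)
    rw [← zero_sub X, ← zero_sub y, ← zero_sub x, kern_reflect, kern_reflect] at this
    exact mul_le_mul (by linarith) this (kern_nonneg _ _ _) (by linarith)

/-- The shape function is negative on the left half of the cell, so the sign is not pointwise.
Writing it as `2 / h ^ 2 * (x - p) * (x - (p + h / 2))`, the factor `(x - p) * kern γ X x`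
increases, and an increasing function integrates nonnegatively against `x - (p + h / 2)`, which is
odd about the midpoint. -/
lemma integral_shapeR_kern_nonneg {γ X p h : ℝ} (hγ₀ : 0 < γ) (hγ : γ < 1) (hh : 0 < h)
    (hX : X ≤ p ∨ X = p + h / 2 ∨ p + h ≤ X) :
    0 ≤ ∫ x in p..p + h, shapeR p h x * kern γ X x := by
  have hodd : ∫ x in p..p + h, (x - (p + h / 2)) = 0 :=
    integral_eq_zero_of_odd fun x => by ring
  have hle : p ≤ p + h := by linarith
  have hI : IntervalIntegrable (fun x => shapeR p h x * kern γ X x) volume p (p + h) :=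
    (intervalIntegrable_kern hγ X _ _).continuousOn_mul (continuous_shapeR p h).continuousOn
  by_cases hm : X = p + h / 2
  -- Here the kernel is even about the midpoint: the odd linear part of the shape function drops
  -- out, and what remains is a nonnegative square.
  · have hodd' : ∫ x in p..p + h, (1 / h) * (x - (p + h / 2)) * kern γ X x = 0 := by
      refine integral_eq_zero_of_odd fun x => ?_
      have := kern_reflect γ (p + (p + h)) X x
      rw [show p + (p + h) - X = X by rw [hm]; ring] at this
      rw [this]; ring
    rw [← hodd']
    refine intervalIntegral.integral_mono_on hle
      ((intervalIntegrable_kern hγ X _ _).continuousOn_mul (by fun_prop)) hI fun x hx => ?_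
    refine mul_le_mul_of_nonneg_right ?_ (kern_nonneg _ _ _)
    have : shapeR p h x = 1 / h * (x - (p + h / 2)) + 2 * (x - (p + h / 2)) ^ 2 / h ^ 2 := by
      unfold shapeR; field_simp; ring
    rw [this]
    have : 0 ≤ 2 * (x - (p + h / 2)) ^ 2 / h ^ 2 := by positivity
    linarith
  · have hX' : X ≤ p ∨ p + h ≤ X := by tauto
    -- `c` is the value of the increasing factor at the midpoint. Replacing that factor by `c`
    -- lowers the integrand on both halves and leaves an integral that vanishes.
    set c := (p + h / 2 - p) * kern γ X (p + h / 2) with hc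
    have h0 : ∫ x in p..p + h, (2 / h ^ 2 * c) * (x - (p + h / 2)) = 0 := by
      rw [intervalIntegral.integral_const_mul, hodd, mul_zero]
    rw [← h0]
    refine intervalIntegral.integral_mono_on_of_le_Ioo hle
      (Continuous.intervalIntegrable (by fun_prop) _ _) hI fun x hx => ?_
    have e : shapeR p h x * kern γ X x =
        2 / h ^ 2 * (((x - p) * kern γ X x) * (x - (p + h / 2))) := by
      unfold shapeR; ring
    rw [e, mul_assoc]
    refine mul_le_mul_of_nonneg_left ?_ (by positivity)
    rcases le_total x (p + h / 2) with h1 | h1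
    · exact mul_le_mul_of_nonpos_right
        (sub_mul_kern_mono hγ₀ hγ hX' hx.1 h1 (by linarith)) (by linarith)
    · exact mul_le_mul_of_nonneg_right
        (sub_mul_kern_mono hγ₀ hγ hX' (by linarith) h1 hx.2) (by linarith)

lemma integral_shapeL_kern_nonneg {γ X p h : ℝ} (hγ₀ : 0 < γ) (hγ : γ < 1) (hh : 0 < h)
    (hX : X ≤ p ∨ X = p + h / 2 ∨ p + h ≤ X) :
    0 ≤ ∫ x in p..p + h, shapeL p h x * kern γ X x := by
  have key := integral_shapeR_kern_nonneg (X := 2 * p + h - X) (p := p) hγ₀ hγ hh (by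
    rcases hX with h1 | h1 | h1
    · right; right; linarith
    · right; left; linarith
    · left; linarith)
  have := intervalIntegral.integral_comp_sub_left (a := p) (b := p + h)
    (fun x => shapeL p h x * kern γ X x) (2 * p + h)
  rw [show 2 * p + h - (p + h) = p by ring, show 2 * p + h - p = p + h by ring] at this
  rw [← this]
  refine key.trans_eq (intervalIntegral.integral_congr fun x _ => ?_)
  have hk := kern_reflect γ (2 * p + h) (2 * p + h - X) x
  rw [sub_sub_cancel] at hk
  simp only [shapeL_reflect, hk]

/-! ### Cellwise description of the basis and the weights -/

lemma node_succ (a h s : ℝ) : node a h (s + 1) = node a h s + h := by unfold node; ring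

lemma node_lt_node {h : ℝ} (hh : 0 < h) (a : ℝ) {s t : ℝ} : node a h s < node a h t ↔ s < t := by
  unfold node; simp [hh]

lemma node_le_node {h : ℝ} (hh : 0 < h) (a : ℝ) {s t : ℝ} : node a h s ≤ node a h t ↔ s ≤ t := by
  unfold node; simp [hh]

lemma step_pos {a b : ℝ} {M : ℕ} (hab : a < b) (hM : 1 ≤ M) : 0 < step a b M := by
  have : (0 : ℝ) < M := by exact_mod_cast hM
  have : 0 < b - a := by linarith
  unfold step; positivity

lemma node_step_last {a b : ℝ} {M : ℕ} (hM : 1 ≤ M) : node a (step a b M) M = b := by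
  have : (M : ℝ) ≠ 0 := by positivity
  unfold node step; field_simp; ring

/-- On the open cell no endpoint shared by two branches of the definition has to be discussed, and
the integrals do not see endpoints. -/
lemma vertexBasis_of_mem_cell {a h : ℝ} (hh : 0 < h) {j m : ℕ} {x : ℝ}
    (hx : x ∈ Ioo (node a h j) (node a h j + h)) :
    vertexBasis a h m x =
      if m = j then shapeL (node a h j) h x
      else if m = j + 1 then shapeR (node a h j) h x else 0 := by
  obtain ⟨hx1, hx2⟩ := hx
  rw [← node_succ] at hx2
  unfold vertexBasis
  rcases lt_or_ge m j with h1 | h1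
  · have h2 : (m : ℝ) + 1 ≤ j := by exact_mod_cast h1
    have h3 : node a h m ≤ node a h j := (node_le_node hh a).2 (by linarith)
    have h4 : node a h (m + 1) ≤ node a h j := (node_le_node hh a).2 h2
    rw [if_neg (fun H => by linarith [H.2]), if_neg (fun H => by linarith [H.2]),
      if_neg (by omega), if_neg (by omega)]
  rcases eq_or_lt_of_le h1 with h1 | h1
  · subst h1
    rw [if_neg (fun H => by linarith [H.2]), if_pos ⟨hx1.le, hx2.le⟩, if_pos rfl, node_succ]
    unfold shapeL; field_simp; ring
  rcases eq_or_lt_of_le (Nat.succ_le_of_lt h1) with h2 | h2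
  · have h3 : m = j + 1 := h2.symm
    have e1 : node a h ((m : ℝ) - 1) = node a h j := by rw [h3]; push_cast; congr 1; ring
    have e2 : node a h (m : ℝ) = node a h j + h := by rw [h3, ← node_succ]; push_cast; rfl
    rw [node_succ] at hx2
    rw [e1, e2, if_pos ⟨hx1.le, hx2.le⟩, if_neg (by omega), if_pos h3]
    unfold shapeR; field_simp; ring
  · have h3 : (j : ℝ) + 1 ≤ (m : ℝ) - 1 := by
      have : (j : ℝ) + 1 + 1 ≤ m := by exact_mod_cast h2
      linarith
    have h4 : node a h (j + 1) ≤ node a h ((m : ℝ) - 1) := (node_le_node hh a).2 h3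
    have h5 : node a h (j + 1) ≤ node a h m := (node_le_node hh a).2 (by linarith)
    rw [if_neg (fun H => by linarith [H.1]), if_neg (fun H => by linarith [H.1]),
      if_neg (by omega), if_neg (by omega)]

lemma midBasis_of_mem_cell {a h : ℝ} (hh : 0 < h) {j m : ℕ} {x : ℝ}
    (hx : x ∈ Ioo (node a h j) (node a h j + h)) :
    midBasis a h (m + 1 / 2) x = if m = j then shapeM (node a h j) h x else 0 := by
  obtain ⟨hx1, hx2⟩ := hx
  unfold midBasis
  rw [show (m : ℝ) + 1 / 2 - 1 / 2 = m by ring, show (m : ℝ) + 1 / 2 + 1 / 2 = m + 1 by ring]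
  rcases lt_trichotomy m j with h1 | h1 | h1
  · have h2 : node a h (m + 1) ≤ node a h j := (node_le_node hh a).2 (by exact_mod_cast h1)
    rw [if_neg (fun H => by linarith [H.2]), if_neg (by omega)]
  · subst h1
    rw [node_succ, if_pos ⟨hx1.le, hx2.le⟩, if_pos rfl, shapeM]
  · have h2 : node a h (j + 1) ≤ node a h m := (node_le_node hh a).2 (by exact_mod_cast h1)
    rw [node_succ] at h2
    rw [if_neg (fun H => by linarith [H.1]), if_neg (by omega)]

/-- The restriction of `φ_{l/2}` to the cell `[x_j, x_{j+1}]`. -/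
noncomputable def cellBasis (a h : ℝ) (j l : ℕ) (x : ℝ) : ℝ :=
  if l = 2 * j then shapeL (node a h j) h x
  else if l = 2 * j + 1 then shapeM (node a h j) h x
  else if l = 2 * j + 2 then shapeR (node a h j) h x else 0

lemma continuous_cellBasis (a h : ℝ) (j l : ℕ) : Continuous (cellBasis a h j l) := by
  unfold cellBasis
  split_ifs
  · exact continuous_shapeL _ _
  · exact continuous_shapeM _ _
  · exact continuous_shapeR _ _
  · exact continuous_const

lemma basis_of_mem_cell {a h : ℝ} (hh : 0 < h) {j l : ℕ} {x : ℝ}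
    (hx : x ∈ Ioo (node a h j) (node a h j + h)) : basis a h l x = cellBasis a h j l x := by
  unfold basis cellBasis
  rcases Nat.even_or_odd' l with ⟨m, hm | hm⟩
  · rw [if_pos (by rw [hm]; exact even_two_mul m),
      show (l : ℝ) / 2 = m by rw [hm]; push_cast; ring, vertexBasis_of_mem_cell hh hx]
    split_ifs <;> first | rfl | omega
  · rw [if_neg (by rw [hm, Nat.not_even_iff_odd]; exact odd_two_mul_add_one m),
      show (l : ℝ) / 2 = m + 1 / 2 by rw [hm]; push_cast; ring, midBasis_of_mem_cell hh hx]
    split_ifs <;> first | rfl | omega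

/-- The value on the cell `[x_j, x_{j+1}]` of the piecewise quadratic interpolant with nodal values
`v`. -/
noncomputable def cellInterp (a h : ℝ) (v : ℕ → ℝ) (j : ℕ) (x : ℝ) : ℝ :=
  v (2 * j) * shapeL (node a h j) h x + v (2 * j + 1) * shapeM (node a h j) h x
    + v (2 * j + 2) * shapeR (node a h j) h x

lemma continuous_cellInterp (a h : ℝ) (v : ℕ → ℝ) (j : ℕ) : Continuous (cellInterp a h v j) := by
  have h1 := continuous_shapeL (node a h j) h
  have h2 := continuous_shapeM (node a h j) h
  have h3 := continuous_shapeR (node a h j) h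
  unfold cellInterp
  fun_prop

lemma sum_mul_cellBasis {a h : ℝ} {v : ℕ → ℝ} {j M : ℕ} (hj : j < M) (x : ℝ) :
    ∑ l ∈ Finset.range (2 * M + 1), v l * cellBasis a h j l x = cellInterp a h v j x := by
  have hsub : ({2 * j, 2 * j + 1, 2 * j + 2} : Finset ℕ) ⊆ Finset.range (2 * M + 1) := by
    intro l hl
    simp only [Finset.mem_insert, Finset.mem_singleton] at hl
    rw [Finset.mem_range]
    omega
  rw [← Finset.sum_subset hsub, Finset.sum_insert (by simp), Finset.sum_insert (by simp),
    Finset.sum_singleton]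
  · simp [cellBasis, cellInterp, add_assoc]
  · intro l _ hl
    simp only [Finset.mem_insert, Finset.mem_singleton, not_or] at hl
    simp [cellBasis, hl.1, hl.2.1, hl.2.2]

/-- Integration over `[a, b]` cell by cell. -/
lemma integral_eq_sum_cells {a b : ℝ} {M : ℕ} (hM : 1 ≤ M) {f : ℝ → ℝ}
    (hf : ∀ j < M, IntervalIntegrable f volume (node a (step a b M) j)
      (node a (step a b M) j + step a b M)) :
    ∫ x in a..b, f x = ∑ j ∈ Finset.range M,
      ∫ x in node a (step a b M) j..node a (step a b M) j + step a b M, f x := by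
  have := intervalIntegral.sum_integral_adjacent_intervals (μ := volume) (f := f)
    (a := fun j : ℕ => node a (step a b M) j) (n := M) (fun j hj => by
      push_cast; rw [node_succ]; exact hf j hj)
  simp only [Nat.cast_add, Nat.cast_one, node_succ, node_step_last hM] at this
  rw [this]
  simp [node]

lemma weight_eq_sum_cells {a b γ : ℝ} (hab : a < b) (hγ : γ < 1) {M : ℕ} (hM : 1 ≤ M) (i l : ℕ) :
    weight a b γ M i l = ∑ j ∈ Finset.range M,
      ∫ x in node a (step a b M) j..node a (step a b M) j + step a b M,
        cellBasis a (step a b M) j l x * kern γ (node a (step a b M) ((i : ℝ) / 2)) x := by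
  have hh := step_pos hab hM
  have heq : ∀ j : ℕ, EqOn
      (fun x => cellBasis a (step a b M) j l x * kern γ (node a (step a b M) ((i : ℝ) / 2)) x)
      (fun x => basis a (step a b M) l x / |node a (step a b M) ((i : ℝ) / 2) - x| ^ γ)
      (uIoo (node a (step a b M) j) (node a (step a b M) j + step a b M)) := by
    intro j x hx
    rw [uIoo_of_le (by linarith)] at hx
    simp only [basis_of_mem_cell hh hx, kern]
    ring
  unfold weight
  rw [integral_eq_sum_cells hM fun j _ => ?_]
  · exact Finset.sum_congr rfl fun j _ => (intervalIntegral.integral_congr_uIoo (heq j)).symm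
  · exact ((intervalIntegrable_kern hγ _ _ _).continuousOn_mul
      (continuous_cellBasis _ _ _ _).continuousOn).congr_uIoo (heq j)

/-- A node never lies inside a half-cell. -/
lemma node_half_cases {a h : ℝ} (hh : 0 < h) (i j : ℕ) :
    node a h ((i : ℝ) / 2) ≤ node a h j ∨ node a h ((i : ℝ) / 2) = node a h j + h / 2 ∨
      node a h j + h ≤ node a h ((i : ℝ) / 2) := by
  rcases lt_trichotomy i (2 * j + 1) with h1 | h1 | h1
  · left
    rw [node_le_node hh]
    have : (i : ℝ) ≤ 2 * j := by exact_mod_cast Nat.le_of_lt_succ h1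
    linarith
  · right; left
    rw [h1]; unfold node; push_cast; ring
  · right; right
    rw [← node_succ, node_le_node hh]
    have : (2 * j + 1 + 1 : ℝ) ≤ i := by exact_mod_cast h1
    linarith

/-- The sign holds cell by cell, because each node is an endpoint or the midpoint of a cell or lies
outside it. Diagonal dominance and the tensor product error bound both rest on it. -/
lemma weight_nonneg {a b γ : ℝ} (hab : a < b) (hγ₀ : 0 < γ) (hγ : γ < 1) {M : ℕ} (hM : 1 ≤ M)
    (i l : ℕ) : 0 ≤ weight a b γ M i l := by
  have hh := step_pos hab hM
  rw [weight_eq_sum_cells hab hγ hM]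
  refine Finset.sum_nonneg fun j _ => ?_
  have hc := node_half_cases (a := a) hh i j
  unfold cellBasis
  split_ifs
  · exact integral_shapeL_kern_nonneg hγ₀ hγ hh hc
  · exact intervalIntegral.integral_nonneg (by linarith) fun x hx =>
      mul_nonneg (shapeM_nonneg hx) (kern_nonneg _ _ _)
  · exact integral_shapeR_kern_nonneg hγ₀ hγ hh hc
  · simp

/-- The quadrature rule integrates the piecewise quadratic interpolant exactly. -/
lemma sum_weight_mul {a b γ : ℝ} (hab : a < b) (hγ : γ < 1) {M : ℕ} (hM : 1 ≤ M) (i : ℕ)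
    (v : ℕ → ℝ) :
    ∑ l ∈ Finset.range (2 * M + 1), weight a b γ M i l * v l = ∑ j ∈ Finset.range M,
      ∫ x in node a (step a b M) j..node a (step a b M) j + step a b M,
        cellInterp a (step a b M) v j x * kern γ (node a (step a b M) ((i : ℝ) / 2)) x := by
  simp only [weight_eq_sum_cells hab hγ hM, Finset.sum_mul]
  rw [Finset.sum_comm]
  refine Finset.sum_congr rfl fun j hj => ?_
  simp only [← intervalIntegral.integral_mul_const]
  rw [← intervalIntegral.integral_finsetSum fun l _ => ?_]
  · refine intervalIntegral.integral_congr fun x _ => ?_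
    simp only [← sum_mul_cellBasis (Finset.mem_range.1 hj), Finset.sum_mul]
    exact Finset.sum_congr rfl fun l _ => by ring
  · exact ((intervalIntegrable_kern hγ _ _ _).continuousOn_mul
      (continuous_cellBasis _ _ _ _).continuousOn).mul_const _

lemma diagWeight_eq (a b γ : ℝ) (M i : ℕ) :
    diagWeight a b γ M i = ∫ x in a..b, kern γ (node a (step a b M) ((i : ℝ) / 2)) x := rfl

/-- The rule is exact for the constant `1`, since the shape functions sum to one. This ties the rows
of `matG` to the diagonal `matD`. -/
lemma sum_weight {a b γ : ℝ} (hab : a < b) (hγ : γ < 1) {M : ℕ} (hM : 1 ≤ M) (i : ℕ) :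
    ∑ l ∈ Finset.range (2 * M + 1), weight a b γ M i l = diagWeight a b γ M i := by
  have hh := step_pos hab hM
  have := sum_weight_mul hab hγ hM i fun _ => 1
  simp only [mul_one] at this
  rw [this, diagWeight_eq, integral_eq_sum_cells hM fun j _ => intervalIntegrable_kern hγ _ _ _]
  refine Finset.sum_congr rfl fun j _ => intervalIntegral.integral_congr fun x _ => ?_
  simp only [cellInterp, one_mul, shape_sum hh.ne']

lemma node_mem_Icc {a b : ℝ} (hab : a < b) {M i : ℕ} (hM : 1 ≤ M) (hi : i ≤ 2 * M) :
    node a (step a b M) ((i : ℝ) / 2) ∈ Icc a b := by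
  have hh := step_pos hab hM
  have h1 : node a (step a b M) 0 = a := by simp [node]
  have h2 : (i : ℝ) ≤ 2 * M := by exact_mod_cast hi
  exact ⟨h1.symm.le.trans ((node_le_node hh a).2 (by positivity)),
    ((node_le_node hh a).2 (by linarith)).trans_eq (node_step_last hM)⟩

lemma diagWeight_le {a b γ : ℝ} (hab : a < b) (hγ : γ < 1) {M i : ℕ} (hM : 1 ≤ M)
    (hi : i ≤ 2 * M) : diagWeight a b γ M i ≤ kernBound a b γ :=
  integral_kern_le hγ (node_mem_Icc hab hM hi).1 (node_mem_Icc hab hM hi).2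

lemma diagWeight_nonneg {a b : ℝ} (hab : a ≤ b) (γ : ℝ) (M i : ℕ) : 0 ≤ diagWeight a b γ M i :=
  intervalIntegral.integral_nonneg hab fun _ _ => kern_nonneg _ _ _

/-! ### The one-dimensional quadrature error -/

lemma iteratedDerivWithin_Icc_subset {w : ℝ → ℝ} {a b p q : ℝ} {n m : ℕ} (hpq : p < q)
    (hab : a < b) (hsub : Icc p q ⊆ Icc a b) (hw : ContDiffOn ℝ n w (Icc a b)) (hm : m ≤ n)
    {x : ℝ} (hx : x ∈ Icc p q) :
    iteratedDerivWithin m w (Icc p q) x = iteratedDerivWithin m w (Icc a b) x := by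
  unfold iteratedDerivWithin
  rw [iteratedFDerivWithin_subset hsub (uniqueDiffOn_Icc hpq) (uniqueDiffOn_Icc hab)
    (hw.of_le (by exact_mod_cast hm)) hx]

/-- Up to terms of fourth order, the error of quadratic interpolation on a cell is a multiple of
the nodal polynomial. -/
lemma exists_interp_error {w : ℝ → ℝ} {p h B : ℝ} (hh : 0 < h)
    (hw : ContDiffOn ℝ 4 w (Icc p (p + h)))
    (hB : ∀ x ∈ Icc p (p + h), ∀ m ≤ 4, |iteratedDerivWithin m w (Icc p (p + h)) x| ≤ B) :
    ∃ κ, |κ| ≤ B ∧ ∀ x ∈ Icc p (p + h),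
      |w x - (w p * shapeL p h x + w (p + h / 2) * shapeM p h x + w (p + h) * shapeR p h x)
        - κ * nodal p h x| ≤ B * h ^ 4 := by
  have hp : p ∈ Icc p (p + h) := ⟨le_rfl, by linarith⟩
  have hm : p + h / 2 ∈ Icc p (p + h) := ⟨by linarith, by linarith⟩
  have hq : p + h ∈ Icc p (p + h) := ⟨by linarith, le_rfl⟩
  have hB0 : 0 ≤ B := (abs_nonneg _).trans (hB p hp 0 (by norm_num))
  set D : ℕ → ℝ := fun m => iteratedDerivWithin m w (Icc p (p + h)) p with hD
  -- The remainder of the cubic Taylor polynomial at the left end of the cell.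
  set r : ℝ → ℝ := fun x =>
    w x - (D 0 + D 1 * (x - p) + D 2 / 2 * (x - p) ^ 2 + D 3 / 6 * (x - p) ^ 3) with hr
  have hrB : ∀ x ∈ Icc p (p + h), |r x| ≤ B * h ^ 4 / 6 := by
    intro x hx
    have key := taylor_mean_remainder_bound (n := 3) (f := w) (C := B) (by linarith : p ≤ p + h)
      (by exact_mod_cast hw) hx (fun y hy => by
        rw [Real.norm_eq_abs]; exact hB y hy 4 le_rfl)
    have e : taylorWithinEval w 3 (Icc p (p + h)) p x =
        D 0 + D 1 * (x - p) + D 2 / 2 * (x - p) ^ 2 + D 3 / 6 * (x - p) ^ 3 := by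
      rw [taylor_within_apply]
      simp only [Finset.sum_range_succ, Finset.sum_range_zero, smul_eq_mul, Nat.factorial, hD]
      push_cast
      ring
    rw [e, Real.norm_eq_abs] at key
    refine key.trans ?_
    have h1 : (x - p) ^ 4 ≤ h ^ 4 :=
      pow_le_pow_left₀ (by linarith [hx.1]) (by linarith [hx.2]) 4
    simp only [Nat.factorial]
    push_cast
    have := mul_le_mul_of_nonneg_left h1 hB0
    linarith
  -- Quadratic interpolation reproduces quadratics, and `(x - p) ^ 3` minus its interpolant is
  -- exactly the nodal cubic; so `κ` is the cubic Taylor coefficient.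
  refine ⟨D 3 / 6, ?_, fun x hx => ?_⟩
  · rw [abs_div, abs_of_pos (by norm_num : (0 : ℝ) < 6)]
    have := hB p hp 3 (by norm_num)
    have h3 : |D 3| ≤ B := this
    linarith [abs_nonneg (D 3)]
  -- What is left is the interpolation error of `r`: four terms, each at most `B * h ^ 4 / 6`.
  · have e : w x - (w p * shapeL p h x + w (p + h / 2) * shapeM p h x + w (p + h) * shapeR p h x)
        - D 3 / 6 * nodal p h x =
        r x - (r p * shapeL p h x + r (p + h / 2) * shapeM p h x + r (p + h) * shapeR p h x) := by
      simp only [hr, shapeL, shapeM, shapeR, nodal]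
      field_simp
      ring
    rw [e]
    have b0 := hrB x hx
    have hE : 0 ≤ B * h ^ 4 / 6 := by positivity
    have bm : ∀ y ∈ Icc p (p + h), ∀ s : ℝ, |s| ≤ 1 → |r y * s| ≤ B * h ^ 4 / 6 := by
      intro y hy s hs
      rw [abs_mul]
      exact (mul_le_mul (hrB y hy) hs (abs_nonneg _) hE).trans_eq (mul_one _)
    have b1 := bm p hp _ (abs_shapeL_le hh hx)
    have b2 := bm _ hm _ (abs_shapeM_le hh hx)
    have b3 := bm _ hq _ (abs_shapeR_le hh hx)
    rw [abs_le] at b0 b1 b2 b3 ⊢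
    constructor <;> linarith [b0.1, b0.2, b1.1, b1.2, b2.1, b2.2, b3.1, b3.2]

/-- The constant in the quadrature error. -/
noncomputable def quadConst (a b γ : ℝ) : ℝ := 2 / (1 - γ) + (b - a) ^ γ * kernBound a b γ

lemma quadConst_nonneg {a b γ : ℝ} (hab : a ≤ b) (hγ : γ < 1) : 0 ≤ quadConst a b γ := by
  have h1 : 0 ≤ b - a := by linarith
  have h2 : 0 ≤ 1 - γ := by linarith
  have h3 := kernBound_nonneg hab hγ
  unfold quadConst
  positivity

lemma gridMass_even (γ a h : ℝ) (i j : ℕ) :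
    gridMass γ a (h / 2) i (2 * j) =
      ∫ x in node a h j..node a h j + h / 2, kern γ (node a h ((i : ℝ) / 2)) x := by
  unfold gridMass node
  push_cast
  rw [show a + (i : ℝ) * (h / 2) = a + i / 2 * h by ring]
  congr 1 <;> ring

lemma gridMass_odd (γ a h : ℝ) (i j : ℕ) :
    gridMass γ a (h / 2) i (2 * j + 1) =
      ∫ x in node a h j + h / 2..node a h j + h, kern γ (node a h ((i : ℝ) / 2)) x := by
  unfold gridMass node
  push_cast
  rw [show a + (i : ℝ) * (h / 2) = a + i / 2 * h by ring]
  congr 1 <;> ring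

lemma cell_subset {a b : ℝ} (hab : a < b) {M j : ℕ} (hM : 1 ≤ M) (hj : j < M) :
    Icc (node a (step a b M) j) (node a (step a b M) j + step a b M) ⊆ Icc a b := by
  have hh := step_pos hab hM
  have h0 : node a (step a b M) 0 = a := by simp [node]
  refine Icc_subset_Icc (h0.symm.le.trans ((node_le_node hh a).2 (by positivity))) ?_
  rw [← node_succ]
  exact ((node_le_node hh a).2 (by exact_mod_cast hj)).trans_eq (node_step_last hM)

/-- The quadrature error of the piecewise quadratic product rule at the nodes is of order
`h^{4-γ}`. -/
theorem abs_quadrature_error_le {a b γ B : ℝ} (hab : a < b) (hγ₀ : 0 < γ) (hγ : γ < 1) {M i : ℕ}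
    (hM : 1 ≤ M) (hi : i ≤ 2 * M) {w : ℝ → ℝ} (hw : ContDiffOn ℝ 4 w (Icc a b))
    (hB : ∀ x ∈ Icc a b, ∀ m ≤ 4, |iteratedDerivWithin m w (Icc a b) x| ≤ B) :
    |(∫ x in a..b, w x * kern γ (node a (step a b M) ((i : ℝ) / 2)) x) -
      ∑ l ∈ Finset.range (2 * M + 1), weight a b γ M i l * w (node a (step a b M) ((l : ℝ) / 2))|
      ≤ quadConst a b γ * B * step a b M ^ (4 - γ) := by
  have hh := step_pos hab hM
  set h := step a b M with hdef
  set X := node a h ((i : ℝ) / 2) with hX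
  have hB0 : 0 ≤ B := (abs_nonneg _).trans (hB a ⟨le_rfl, hab.le⟩ 0 (by norm_num))
  have hcell : ∀ j < M, Icc (node a h j) (node a h j + h) ⊆ Icc a b :=
    fun j hj => cell_subset hab hM hj
  have hIw : ∀ j < M, IntervalIntegrable (fun x => w x * kern γ X x) volume (node a h j)
      (node a h j + h) := fun j hj => (intervalIntegrable_kern hγ _ _ _).continuousOn_mul (by
    rw [uIcc_of_le (by linarith)]
    exact hw.continuousOn.mono (hcell j hj))
  have hIP : ∀ j, IntervalIntegrable (fun x => cellInterp a h
      (fun l => w (node a h ((l : ℝ) / 2))) j x * kern γ X x) volume (node a h j)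
      (node a h j + h) := fun j => (intervalIntegrable_kern hγ _ _ _).continuousOn_mul
    (continuous_cellInterp _ _ _ _).continuousOn
  rw [sum_weight_mul hab hγ hM, integral_eq_sum_cells hM hIw, ← Finset.sum_sub_distrib]
  have hone : ∀ j ∈ Finset.range M,
      |(∫ x in node a h j..node a h j + h, w x * kern γ X x) -
        ∫ x in node a h j..node a h j + h,
          cellInterp a h (fun l => w (node a h ((l : ℝ) / 2))) j x * kern γ X x| ≤
      B * h ^ 3 * |gridMass γ a (h / 2) i (2 * j) - gridMass γ a (h / 2) i (2 * j + 1)|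
        + B * h ^ 4 * ∫ x in node a h j..node a h j + h, kern γ X x := by
    intro j hj
    have hj' := Finset.mem_range.1 hj
    set p := node a h j with hp
    have hsub := hcell j hj'
    obtain ⟨κ, hκ, hκ'⟩ := exists_interp_error (p := p) (B := B) hh (hw.mono hsub)
      (fun x hx m hm => by
        rw [iteratedDerivWithin_Icc_subset (n := 4) (by linarith) hab hsub hw hm hx]
        exact hB x (hsub hx) m hm)
    have hIN : IntervalIntegrable (fun x => κ * (nodal p h x * kern γ X x)) volume p (p + h) :=
      ((intervalIntegrable_kern hγ _ _ _).continuousOn_mul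
        (continuous_nodal p h).continuousOn).const_mul κ
    have e1 : cellInterp a h (fun l => w (node a h ((l : ℝ) / 2))) j = fun x =>
        w p * shapeL p h x + w (p + h / 2) * shapeM p h x + w (p + h) * shapeR p h x := by
      have n0 : node a h (((2 * j : ℕ) : ℝ) / 2) = p := by
        rw [hp]; unfold node; push_cast; ring
      have n1 : node a h (((2 * j + 1 : ℕ) : ℝ) / 2) = p + h / 2 := by
        rw [hp]; unfold node; push_cast; ring
      have n2 : node a h (((2 * j + 2 : ℕ) : ℝ) / 2) = p + h := by
        rw [hp]; unfold node; push_cast; ring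
      funext x
      simp only [cellInterp, n0, n1, n2, ← hp]
    have e2 : (∫ x in p..p + h, w x * kern γ X x) -
        (∫ x in p..p + h, cellInterp a h (fun l => w (node a h ((l : ℝ) / 2))) j x * kern γ X x) =
        κ * (∫ x in p..p + h, nodal p h x * kern γ X x) +
        ∫ x in p..p + h, ((w x * kern γ X x - cellInterp a h
          (fun l => w (node a h ((l : ℝ) / 2))) j x * kern γ X x) -
            κ * (nodal p h x * kern γ X x)) := by
      rw [intervalIntegral.integral_sub ((hIw j hj').sub (hIP j)) hIN,
        intervalIntegral.integral_sub (hIw j hj') (hIP j), intervalIntegral.integral_const_mul]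
      ring
    rw [e2]
    refine (abs_add_le _ _).trans (add_le_add ?_ ?_)
    · rw [abs_mul, gridMass_even, gridMass_odd, mul_assoc]
      exact mul_le_mul hκ (abs_integral_nodal_kern hγ₀ hγ hh (node_half_cases hh i j))
        (abs_nonneg _) hB0
    · rw [← intervalIntegral.integral_const_mul]
      refine abs_integral_le_of_abs_le (by linarith)
        ((intervalIntegrable_kern hγ _ _ _).const_mul _) fun x hx => ?_
      rw [e1, ← sub_mul, ← mul_assoc, ← sub_mul, abs_mul, abs_of_nonneg (kern_nonneg γ X x)]
      exact mul_le_mul_of_nonneg_right (hκ' x ⟨hx.1.le, hx.2⟩) (kern_nonneg γ X x)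
  refine (Finset.abs_sum_le_sum_abs _ _).trans ((Finset.sum_le_sum hone).trans ?_)
  rw [Finset.sum_add_distrib, ← Finset.mul_sum, ← Finset.mul_sum,
    ← integral_eq_sum_cells hM fun j _ => intervalIntegrable_kern hγ _ _ _]
  -- The sum over the cells of the nodal parts gives the first term of `quadConst`; the remainders,
  -- `h ^ 4` times the total kernel mass, give the second.
  have s1 := sum_abs_gridMass_sub_le (p := a) hγ₀ hγ (half_pos hh) i M
  rw [shellMass_zero hγ (half_pos hh).le] at s1
  have s2 := diagWeight_le hab hγ hM hi
  rw [diagWeight_eq] at s2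
  have h1γ : 0 < 1 - γ := by linarith
  have s3 : (h / 2) ^ (1 - γ) ≤ h ^ (1 - γ) :=
    Real.rpow_le_rpow (half_pos hh).le (by linarith) h1γ.le
  -- Trades the surplus power in `h ^ 4 = h ^ (4 - γ) * h ^ γ` for a constant.
  have s4 : h ^ γ ≤ (b - a) ^ γ := by
    refine Real.rpow_le_rpow hh.le ?_ hγ₀.le
    rw [hdef, step]
    exact div_le_self (by linarith) (by exact_mod_cast hM)
  have p1 : h ^ 3 * h ^ (1 - γ) = h ^ (4 - γ) := by
    rw [← Real.rpow_natCast, ← Real.rpow_add hh]; congr 1; push_cast; ring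
  have p2 : h ^ 4 = h ^ (4 - γ) * h ^ γ := by
    rw [← Real.rpow_add hh, ← Real.rpow_natCast]; congr 1; push_cast; ring
  have hkb := kernBound_nonneg hab.le hγ
  calc _ ≤ B * h ^ 3 * (2 * ((h / 2) ^ (1 - γ) / (1 - γ))) + B * h ^ 4 * kernBound a b γ := by
        gcongr
    _ ≤ B * h ^ 3 * (2 * (h ^ (1 - γ) / (1 - γ)))
          + B * (h ^ (4 - γ) * (b - a) ^ γ) * kernBound a b γ := by
        rw [p2]; gcongr
    _ = _ := by
        rw [quadConst, ← p1]; ring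

/-! ### Coordinate slices and the tensor product rule -/

open scoped Pointwise in
/-- The derivatives of a function along an affine line of unit speed are bounded by its
multivariate derivatives. -/
lemma abs_iteratedDerivWithin_comp_affine_le {F : ℝ × ℝ → ℝ} {S S' : Set (ℝ × ℝ)} {I : Set ℝ}
    {ℓ : ℝ →L[ℝ] ℝ × ℝ} {z : ℝ × ℝ} {n m : ℕ} (hF : ContDiffOn ℝ n F S) (hS : z +ᵥ S' = S)
    (hS' : UniqueDiffOn ℝ S') (hI : ℓ ⁻¹' S' = I) (hI' : UniqueDiffOn ℝ I) (hℓ : ‖ℓ‖ ≤ 1)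
    (hm : m ≤ n) {x : ℝ} (hx : x ∈ I) :
    |iteratedDerivWithin m (fun x => F (ℓ x + z)) I x| ≤
      ‖iteratedFDerivWithin ℝ m F S (ℓ x + z)‖ := by
  have hmaps : MapsTo (fun q => q + z) S' S := by
    intro q hq
    change q + z ∈ S
    rw [← hS, add_comm, ← vadd_eq_add]
    exact Set.vadd_mem_vadd_set hq
  have hG : ContDiffOn ℝ n (fun q => F (q + z)) S' :=
    hF.comp (by fun_prop) hmaps
  have h1 := ℓ.iteratedFDerivWithin_comp_right hG hS' (by rw [hI]; exact hI')
    (x := x) (by rw [← mem_preimage, hI]; exact hx) (i := m) (by exact_mod_cast hm)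
  rw [hI] at h1
  rw [← Real.norm_eq_abs, ← norm_iteratedFDerivWithin_eq_norm_iteratedDerivWithin]
  change ‖iteratedFDerivWithin ℝ m ((fun q => F (q + z)) ∘ ℓ) I x‖ ≤ _
  rw [h1, iteratedFDerivWithin_comp_add_right, hS]
  refine (ContinuousMultilinearMap.norm_compContinuousLinearMap_le _ _).trans ?_
  refine mul_le_of_le_one_right (norm_nonneg _) ?_
  exact Finset.prod_le_one (fun _ _ => norm_nonneg _) fun _ _ => hℓ

/-- The function `v` has derivatives of order at most four on the rectangle
`[a, b] × [c, d]` that are bounded by `B` along the coordinate directions. -/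
structure SlicesBounded (a b c d B : ℝ) (v : ℝ → ℝ → ℝ) : Prop where
  continuousOn : ContinuousOn (fun p : ℝ × ℝ => v p.1 p.2) (Icc a b ×ˢ Icc c d)
  contDiffOn_left : ∀ y ∈ Icc c d, ContDiffOn ℝ 4 (fun x => v x y) (Icc a b)
  contDiffOn_right : ∀ x ∈ Icc a b, ContDiffOn ℝ 4 (fun y => v x y) (Icc c d)
  bound_left : ∀ y ∈ Icc c d, ∀ x ∈ Icc a b, ∀ m ≤ 4,
    |iteratedDerivWithin m (fun x => v x y) (Icc a b) x| ≤ B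
  bound_right : ∀ x ∈ Icc a b, ∀ y ∈ Icc c d, ∀ m ≤ 4,
    |iteratedDerivWithin m (fun y => v x y) (Icc c d) y| ≤ B

-- A coordinate line is a linear embedding (`inl` or `inr`) followed by a translation; `S'` is the
-- rectangle shifted so that the line passes through the origin. The embeddings have norm at most
-- one, so the bound `B` is inherited unchanged.
open scoped Pointwise in
lemma slicesBounded_of_contDiffOn {a b c d B : ℝ} (hab : a < b) (hcd : c < d) {v : ℝ → ℝ → ℝ}
    (hv : ContDiffOn ℝ 4 (fun p : ℝ × ℝ => v p.1 p.2) (Icc a b ×ˢ Icc c d))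
    (hB : ∀ p ∈ Icc a b ×ˢ Icc c d, ∀ m ≤ 4, ‖iteratedFDerivWithin ℝ m
      (fun q : ℝ × ℝ => v q.1 q.2) (Icc a b ×ˢ Icc c d) p‖ ≤ B) :
    SlicesBounded a b c d B v where
  continuousOn := hv.continuousOn
  contDiffOn_left y hy := hv.comp (f := fun x : ℝ => (x, y)) (by fun_prop) fun x hx => ⟨hx, hy⟩
  contDiffOn_right x hx := hv.comp (f := fun y : ℝ => (x, y)) (by fun_prop) fun y hy => ⟨hx, hy⟩
  bound_left y hy x hx m hm := by
    have key := abs_iteratedDerivWithin_comp_affine_le (n := 4) (m := m)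
      (F := fun p : ℝ × ℝ => v p.1 p.2) (S := Icc a b ×ˢ Icc c d)
      (S' := Icc a b ×ˢ Icc (c - y) (d - y)) (I := Icc a b) (ℓ := ContinuousLinearMap.inl ℝ ℝ ℝ)
      (z := (0, y)) hv (by
        ext ⟨s, t⟩
        rw [Set.mem_vadd_set_iff_neg_vadd_mem]
        simp only [vadd_eq_add, mem_prod, mem_Icc, Prod.neg_mk, Prod.mk_add_mk, neg_zero, zero_add]
        refine and_congr Iff.rfl (and_congr ?_ ?_) <;> constructor <;> intro <;> linarith)
      ((uniqueDiffOn_Icc hab).prod (uniqueDiffOn_Icc (by linarith)))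
      (by
        ext s
        simp only [mem_preimage, ContinuousLinearMap.inl_apply, mem_prod, mem_Icc]
        exact ⟨fun H => H.1, fun H => ⟨H, by linarith [hy.1], by linarith [hy.2]⟩⟩)
      (uniqueDiffOn_Icc hab) (ContinuousLinearMap.norm_inl_le_one ℝ ℝ ℝ) hm hx
    simp only [ContinuousLinearMap.inl_apply, Prod.mk_add_mk, add_zero, zero_add] at key
    exact key.trans (hB (x, y) ⟨hx, hy⟩ m hm)
  bound_right x hx y hy m hm := by
    have key := abs_iteratedDerivWithin_comp_affine_le (n := 4) (m := m)
      (F := fun p : ℝ × ℝ => v p.1 p.2) (S := Icc a b ×ˢ Icc c d)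
      (S' := Icc (a - x) (b - x) ×ˢ Icc c d) (I := Icc c d) (ℓ := ContinuousLinearMap.inr ℝ ℝ ℝ)
      (z := (x, 0)) hv (by
        ext ⟨s, t⟩
        rw [Set.mem_vadd_set_iff_neg_vadd_mem]
        simp only [vadd_eq_add, mem_prod, mem_Icc, Prod.neg_mk, Prod.mk_add_mk, neg_zero, zero_add]
        refine and_congr (and_congr ?_ ?_) Iff.rfl <;> constructor <;> intro <;> linarith)
      ((uniqueDiffOn_Icc (by linarith)).prod (uniqueDiffOn_Icc hcd))
      (by
        ext s
        simp only [mem_preimage, ContinuousLinearMap.inr_apply, mem_prod, mem_Icc]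
        exact ⟨fun H => H.2, fun H => ⟨⟨by linarith [hx.1], by linarith [hx.2]⟩, H⟩⟩)
      (uniqueDiffOn_Icc hcd) (ContinuousLinearMap.norm_inr_le_one ℝ ℝ ℝ) hm hy
    simp only [ContinuousLinearMap.inr_apply, Prod.mk_add_mk, add_zero, zero_add] at key
    exact key.trans (hB (x, y) ⟨hx, hy⟩ m hm)

lemma integrableOn_kern_Icc {γ : ℝ} (hγ : γ < 1) (X : ℝ) {a b : ℝ} (hab : a ≤ b) :
    IntegrableOn (kern γ X) (Icc a b) :=
  (intervalIntegrable_iff_integrableOn_Icc_of_le hab).1 (intervalIntegrable_kern hγ X a b)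

lemma integrableOn_mul_kern_prod {γ : ℝ} (hγ : γ < 1) {a b c d : ℝ} (hab : a ≤ b) (hcd : c ≤ d)
    (X Y : ℝ) {v : ℝ → ℝ → ℝ}
    (hv : ContinuousOn (fun p : ℝ × ℝ => v p.1 p.2) (Icc a b ×ˢ Icc c d)) :
    IntegrableOn (fun p : ℝ × ℝ => v p.1 p.2 * (kern γ X p.1 * kern γ Y p.2))
      (Ioo a b ×ˢ Ioo c d) := by
  have hk : IntegrableOn (fun p : ℝ × ℝ => kern γ X p.1 * kern γ Y p.2) (Icc a b ×ˢ Icc c d) := by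
    rw [IntegrableOn, Measure.volume_eq_prod, ← Measure.prod_restrict]
    exact Integrable.mul_prod (integrableOn_kern_Icc hγ X hab) (integrableOn_kern_Icc hγ Y hcd)
  exact (hk.continuousOn_mul hv (isCompact_Icc.prod isCompact_Icc)).mono_set
    (prod_mono Ioo_subset_Icc_self Ioo_subset_Icc_self)

lemma integral_Ioo_eq {f : ℝ → ℝ} {a b : ℝ} (hab : a ≤ b) :
    ∫ x in Ioo a b, f x = ∫ x in a..b, f x := by
  rw [intervalIntegral.integral_of_le hab, integral_Ioc_eq_integral_Ioo]

lemma setIntegral_mul_kern_prod {γ : ℝ} (hγ : γ < 1) {a b c d : ℝ} (hab : a ≤ b) (hcd : c ≤ d)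
    (X Y : ℝ) {v : ℝ → ℝ → ℝ}
    (hv : ContinuousOn (fun p : ℝ × ℝ => v p.1 p.2) (Icc a b ×ˢ Icc c d)) :
    ∫ p in Ioo a b ×ˢ Ioo c d, v p.1 p.2 * (kern γ X p.1 * kern γ Y p.2) =
      ∫ y in c..d, (∫ x in a..b, v x y * kern γ X x) * kern γ Y y := by
  have hI := integrableOn_mul_kern_prod hγ hab hcd X Y hv
  rw [IntegrableOn, Measure.volume_eq_prod, ← Measure.prod_restrict] at hI
  rw [Measure.volume_eq_prod, ← Measure.prod_restrict, integral_prod_symm _ hI,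
    integral_Ioo_eq hcd]
  refine intervalIntegral.integral_congr fun y _ => ?_
  simp only [integral_Ioo_eq hab]
  rw [← intervalIntegral.integral_mul_const]
  exact intervalIntegral.integral_congr fun x _ => by ring

lemma intervalIntegrable_integral_mul_kern {γ : ℝ} (hγ : γ < 1) {a b c d : ℝ} (hab : a ≤ b)
    (hcd : c ≤ d) (X Y : ℝ) {v : ℝ → ℝ → ℝ}
    (hv : ContinuousOn (fun p : ℝ × ℝ => v p.1 p.2) (Icc a b ×ˢ Icc c d)) :
    IntervalIntegrable (fun y => (∫ x in a..b, v x y * kern γ X x) * kern γ Y y) volume c d := by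
  have hI := integrableOn_mul_kern_prod hγ hab hcd X Y hv
  rw [IntegrableOn, Measure.volume_eq_prod, ← Measure.prod_restrict] at hI
  rw [intervalIntegrable_iff_integrableOn_Ioo_of_le hcd]
  refine hI.integral_prod_right.congr (Filter.Eventually.of_forall fun y => ?_)
  simp only [integral_Ioo_eq hab]
  rw [← intervalIntegral.integral_mul_const]
  exact intervalIntegral.integral_congr fun x _ => by ring

/-- As the kernel is integrable, the two terms of the difference may be integrated separately; at a
node the coefficient of `v X Y` is then exactly the product of the diagonal weights. -/
lemma nonlocalOp_eq {γ : ℝ} (hγ : γ < 1) {a b c d : ℝ} (hab : a ≤ b) (hcd : c ≤ d)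
    (X Y : ℝ) {v : ℝ → ℝ → ℝ}
    (hv : ContinuousOn (fun p : ℝ × ℝ => v p.1 p.2) (Icc a b ×ˢ Icc c d)) :
    nonlocalOp a b c d γ v X Y =
      (∫ x in a..b, kern γ X x) * (∫ y in c..d, kern γ Y y) * v X Y -
        ∫ y in c..d, (∫ x in a..b, v x y * kern γ X x) * kern γ Y y := by
  have hIc := integrableOn_mul_kern_prod hγ hab hcd X Y (v := fun _ _ => v X Y) continuousOn_const
  have hc := setIntegral_mul_kern_prod hγ hab hcd X Y (v := fun _ _ => v X Y) continuousOn_const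
  have e : ∀ p : ℝ × ℝ, (v X Y - v p.1 p.2) / (|X - p.1| ^ γ * |Y - p.2| ^ γ) =
      v X Y * (kern γ X p.1 * kern γ Y p.2) - v p.1 p.2 * (kern γ X p.1 * kern γ Y p.2) := by
    intro p
    rw [← sub_mul, kern, kern, div_mul_div_comm, one_mul, mul_one_div]
  unfold nonlocalOp
  simp only [e]
  rw [integral_sub hIc (integrableOn_mul_kern_prod hγ hab hcd X Y hv),
    setIntegral_mul_kern_prod hγ hab hcd X Y hv, hc]
  simp only [intervalIntegral.integral_const_mul]
  ring

/-- The error of the tensor product quadrature rule. -/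
theorem abs_tensor_quadrature_error_le {a b c d γ B : ℝ} (hab : a < b) (hcd : c < d) (hγ₀ : 0 < γ)
    (hγ : γ < 1) {Mx My i j : ℕ} (hMx : 1 ≤ Mx) (hMy : 1 ≤ My) (hi : i ≤ 2 * Mx)
    (hj : j ≤ 2 * My) {v : ℝ → ℝ → ℝ} (hv : SlicesBounded a b c d B v) :
    |(∫ y in c..d, (∫ x in a..b, v x y * kern γ (node a (step a b Mx) ((i : ℝ) / 2)) x) *
        kern γ (node c (step c d My) ((j : ℝ) / 2)) y) -
      ∑ l ∈ Finset.range (2 * Mx + 1), ∑ r ∈ Finset.range (2 * My + 1),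
        weight a b γ Mx i l * weight c d γ My j r *
          v (node a (step a b Mx) ((l : ℝ) / 2)) (node c (step c d My) ((r : ℝ) / 2))| ≤
      quadConst a b γ * B * step a b Mx ^ (4 - γ) * kernBound c d γ +
        kernBound a b γ * (quadConst c d γ * B * step c d My ^ (4 - γ)) := by
  set X : ℕ → ℝ := fun l => node a (step a b Mx) ((l : ℝ) / 2) with hX
  set Y : ℕ → ℝ := fun r => node c (step c d My) ((r : ℝ) / 2) with hY
  have hXm : ∀ l ∈ Finset.range (2 * Mx + 1), X l ∈ Icc a b := fun l hl =>
    node_mem_Icc hab hMx (Nat.le_of_lt_succ (Finset.mem_range.1 hl))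
  have hB0 : 0 ≤ B := (abs_nonneg _).trans
    (hv.bound_left c ⟨le_rfl, hcd.le⟩ a ⟨le_rfl, hab.le⟩ 0 (by norm_num))
  have hεx : 0 ≤ quadConst a b γ * B * step a b Mx ^ (4 - γ) :=
    mul_nonneg (mul_nonneg (quadConst_nonneg hab.le hγ) hB0)
      (Real.rpow_nonneg (step_pos hab hMx).le _)
  have hεy : 0 ≤ quadConst c d γ * B * step c d My ^ (4 - γ) :=
    mul_nonneg (mul_nonneg (quadConst_nonneg hcd.le hγ) hB0)
      (Real.rpow_nonneg (step_pos hcd hMy).le _)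
  have hIv := intervalIntegrable_integral_mul_kern hγ hab.le hcd.le (X i) (Y j) hv.continuousOn
  have hIl : ∀ l ∈ Finset.range (2 * Mx + 1),
      IntervalIntegrable (fun y => weight a b γ Mx i l * (v (X l) y * kern γ (Y j) y))
        volume c d := fun l hl =>
    ((intervalIntegrable_kern hγ _ _ _).continuousOn_mul (by
      rw [uIcc_of_le hcd.le]
      exact (hv.contDiffOn_right _ (hXm l hl)).continuousOn)).const_mul _
  have hIs : IntervalIntegrable (fun y => ∑ l ∈ Finset.range (2 * Mx + 1),
      weight a b γ Mx i l * (v (X l) y * kern γ (Y j) y)) volume c d := by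
    refine (IntervalIntegrable.sum (Finset.range (2 * Mx + 1)) hIl).congr fun y _ => ?_
    simp only [Finset.sum_apply]
  -- Quadrature is performed in `x` first, for each fixed `y`, and then in `y` along the lines `x =
  -- X l`. The first error is integrated against the `y`-kernel, the second is averaged with the
  -- nonnegative `x`-weights.
  have split : (∫ y in c..d, (∫ x in a..b, v x y * kern γ (X i) x) * kern γ (Y j) y) -
      ∑ l ∈ Finset.range (2 * Mx + 1), ∑ r ∈ Finset.range (2 * My + 1),
        weight a b γ Mx i l * weight c d γ My j r * v (X l) (Y r) =
      (∫ y in c..d, ((∫ x in a..b, v x y * kern γ (X i) x) * kern γ (Y j) y -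
        ∑ l ∈ Finset.range (2 * Mx + 1), weight a b γ Mx i l * (v (X l) y * kern γ (Y j) y))) +
      ∑ l ∈ Finset.range (2 * Mx + 1), weight a b γ Mx i l *
        ((∫ y in c..d, v (X l) y * kern γ (Y j) y) -
          ∑ r ∈ Finset.range (2 * My + 1), weight c d γ My j r * v (X l) (Y r)) := by
    rw [intervalIntegral.integral_sub hIv hIs, intervalIntegral.integral_finsetSum hIl]
    simp only [intervalIntegral.integral_const_mul, mul_sub, Finset.sum_sub_distrib,
      Finset.mul_sum, mul_assoc]
    ring
  rw [split]
  refine (abs_add_le _ _).trans (add_le_add ?_ ?_)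
  · calc _ ≤ ∫ y in c..d, quadConst a b γ * B * step a b Mx ^ (4 - γ) * kern γ (Y j) y := by
          refine abs_integral_le_of_abs_le hcd.le
            ((intervalIntegrable_kern hγ _ _ _).const_mul _) fun y hy => ?_
          have hy' : y ∈ Icc c d := ⟨hy.1.le, hy.2⟩
          simp only [← mul_assoc]
          rw [← Finset.sum_mul, ← sub_mul, abs_mul, abs_of_nonneg (kern_nonneg γ (Y j) y)]
          exact mul_le_mul_of_nonneg_right (abs_quadrature_error_le hab hγ₀ hγ hMx hi
            (hv.contDiffOn_left y hy') (hv.bound_left y hy')) (kern_nonneg _ _ _)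
      _ ≤ _ := by
          rw [intervalIntegral.integral_const_mul]
          exact mul_le_mul_of_nonneg_left (diagWeight_le hcd hγ hMy hj) hεx
  · calc _ ≤ ∑ l ∈ Finset.range (2 * Mx + 1), weight a b γ Mx i l *
          (quadConst c d γ * B * step c d My ^ (4 - γ)) := by
          refine (Finset.abs_sum_le_sum_abs _ _).trans (Finset.sum_le_sum fun l hl => ?_)
          have hw := weight_nonneg hab hγ₀ hγ hMx i l
          rw [abs_mul, abs_of_nonneg hw]
          exact mul_le_mul_of_nonneg_left (abs_quadrature_error_le hcd hγ₀ hγ hMy hj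
            (hv.contDiffOn_right _ (hXm l hl)) (hv.bound_right _ (hXm l hl))) hw
      _ ≤ _ := by
          rw [← Finset.sum_mul, sum_weight hab hγ hMx]
          exact mul_le_mul_of_nonneg_right (diagWeight_le hab hγ hMx hi) hεy

/-! ### Maximum norm stability and unique solvability -/

lemma sum_fin_succ_eq_sum_Icc (f : ℕ → ℝ) (n : ℕ) :
    ∑ i : Fin n, f ((i : ℕ) + 1) = ∑ l ∈ Finset.Icc 1 n, f l := by
  rw [Fin.sum_univ_eq_sum_range (fun l => f (l + 1)) n, Finset.range_eq_Ico,
    Finset.sum_Ico_add' f 0 n 1]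
  rfl

lemma sum_range_eq_add_sum_Icc_add (f : ℕ → ℝ) {M : ℕ} (hM : 1 ≤ M) :
    ∑ l ∈ Finset.range (2 * M + 1), f l =
      f 0 + ∑ l ∈ Finset.Icc 1 (2 * M - 1), f l + f (2 * M) := by
  obtain ⟨n, hn⟩ : ∃ n, 2 * M = n + 1 := ⟨2 * M - 1, by omega⟩
  rw [hn, Finset.sum_range_succ, Finset.sum_range_succ', Nat.add_sub_cancel,
    ← sum_fin_succ_eq_sum_Icc, Fin.sum_univ_eq_sum_range (fun l => f (l + 1)) n]
  ring

section Stability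

variable {a b c d γ : ℝ} {Mx My : ℕ}

/-- The tensor product quadrature weights between interior nodes. -/
noncomputable def gridWeight (a b c d γ : ℝ) (Mx My : ℕ) (p q : Grid Mx My) : ℝ :=
  weight a b γ Mx ((p.1 : ℕ) + 1) ((q.1 : ℕ) + 1) * weight c d γ My ((p.2 : ℕ) + 1) ((q.2 : ℕ) + 1)

/-- The diagonal of `𝒟_x ⊗ 𝒟_y`. -/
noncomputable def gridDiag (a b c d γ : ℝ) (Mx My : ℕ) (p : Grid Mx My) : ℝ :=
  diagWeight a b γ Mx ((p.1 : ℕ) + 1) * diagWeight c d γ My ((p.2 : ℕ) + 1)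

lemma matA_mulVec_apply (s : Grid Mx My → ℝ) (p : Grid Mx My) :
    (matA a b c d γ Mx My).mulVec s p =
      gridDiag a b c d γ Mx My p * s p - ∑ q, gridWeight a b c d γ Mx My p q * s q := by
  unfold matA matD
  rw [Matrix.diagonal_kronecker_diagonal, Matrix.sub_mulVec, Pi.sub_apply,
    Matrix.mulVec_diagonal]
  rfl

lemma index_succ_le (p : Fin (2 * Mx - 1)) : (p : ℕ) + 1 ≤ 2 * Mx := by
  have := p.2
  omega

lemma gridWeight_nonneg (hab : a < b) (hcd : c < d) (hγ₀ : 0 < γ) (hγ : γ < 1) (hMx : 1 ≤ Mx)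
    (hMy : 1 ≤ My) (p q : Grid Mx My) : 0 ≤ gridWeight a b c d γ Mx My p q :=
  mul_nonneg (weight_nonneg hab hγ₀ hγ hMx _ _) (weight_nonneg hcd hγ₀ hγ hMy _ _)

lemma gridDiag_nonneg (hab : a ≤ b) (hcd : c ≤ d) (p : Grid Mx My) :
    0 ≤ gridDiag a b c d γ Mx My p :=
  mul_nonneg (diagWeight_nonneg hab _ _ _) (diagWeight_nonneg hcd _ _ _)

lemma gridDiag_le (hab : a < b) (hcd : c < d) (hγ : γ < 1) (hMx : 1 ≤ Mx) (hMy : 1 ≤ My)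
    (p : Grid Mx My) : gridDiag a b c d γ Mx My p ≤ kernBound a b γ * kernBound c d γ :=
  mul_le_mul (diagWeight_le hab hγ hMx (index_succ_le p.1))
    (diagWeight_le hcd hγ hMy (index_succ_le p.2)) (diagWeight_nonneg hcd.le _ _ _)
    (kernBound_nonneg hab.le hγ)

lemma sum_interior_weight_le (hab : a < b) (hγ₀ : 0 < γ) (hγ : γ < 1) (hMx : 1 ≤ Mx) (i : ℕ) :
    ∑ l : Fin (2 * Mx - 1), weight a b γ Mx i ((l : ℕ) + 1) ≤ diagWeight a b γ Mx i := by
  rw [sum_fin_succ_eq_sum_Icc, ← sum_weight hab hγ hMx, sum_range_eq_add_sum_Icc_add _ hMx]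
  linarith [weight_nonneg hab hγ₀ hγ hMx i 0, weight_nonneg hab hγ₀ hγ hMx i (2 * Mx)]

/-- `𝒜` is weakly diagonally dominant. -/
lemma sum_gridWeight_le (hab : a < b) (hcd : c < d) (hγ₀ : 0 < γ) (hγ : γ < 1) (hMx : 1 ≤ Mx)
    (hMy : 1 ≤ My) (p : Grid Mx My) :
    ∑ q, gridWeight a b c d γ Mx My p q ≤ gridDiag a b c d γ Mx My p := by
  unfold gridWeight gridDiag
  rw [Fintype.sum_prod_type]
  simp only [← Finset.mul_sum, ← Finset.sum_mul]
  exact mul_le_mul (sum_interior_weight_le hab hγ₀ hγ hMx _)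
    (sum_interior_weight_le hcd hγ₀ hγ hMy _)
    (Finset.sum_nonneg fun _ _ => weight_nonneg hcd hγ₀ hγ hMy _ _) (diagWeight_nonneg hab.le _ _ _)

lemma abs_sum_gridWeight_mul_le (hab : a < b) (hcd : c < d) (hγ₀ : 0 < γ) (hγ : γ < 1)
    (hMx : 1 ≤ Mx) (hMy : 1 ≤ My) (p : Grid Mx My) (s : Grid Mx My → ℝ) :
    |∑ q, gridWeight a b c d γ Mx My p q * s q| ≤ gridDiag a b c d γ Mx My p * ‖s‖ := by
  have hw := gridWeight_nonneg hab hcd hγ₀ hγ hMx hMy p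
  calc _ ≤ ∑ q, gridWeight a b c d γ Mx My p q * ‖s‖ := by
        refine (Finset.abs_sum_le_sum_abs _ _).trans (Finset.sum_le_sum fun q _ => ?_)
        rw [abs_mul, abs_of_nonneg (hw q)]
        exact mul_le_mul_of_nonneg_left (norm_le_pi_norm s q) (hw q)
    _ ≤ _ := by
        rw [← Finset.sum_mul]
        exact mul_le_mul_of_nonneg_right (sum_gridWeight_le hab hcd hγ₀ hγ hMx hMy p)
          (norm_nonneg _)

/-- The bound does not depend on the mesh, because both the diagonal and the row sums are controlled
by kernel masses. This is why no restriction on `τ` is needed. -/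
lemma norm_matA_mulVec_le (hab : a < b) (hcd : c < d) (hγ₀ : 0 < γ) (hγ : γ < 1) (hMx : 1 ≤ Mx)
    (hMy : 1 ≤ My) (s : Grid Mx My → ℝ) :
    ‖(matA a b c d γ Mx My).mulVec s‖ ≤ 2 * (kernBound a b γ * kernBound c d γ) * ‖s‖ := by
  have hK : 0 ≤ kernBound a b γ * kernBound c d γ :=
    mul_nonneg (kernBound_nonneg hab.le hγ) (kernBound_nonneg hcd.le hγ)
  refine (pi_norm_le_iff_of_nonneg (by positivity)).2 fun p => ?_
  rw [matA_mulVec_apply, Real.norm_eq_abs]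
  have h1 := abs_sum_gridWeight_mul_le hab hcd hγ₀ hγ hMx hMy p s
  have h2 : |gridDiag a b c d γ Mx My p * s p| ≤ gridDiag a b c d γ Mx My p * ‖s‖ := by
    rw [abs_mul, abs_of_nonneg (gridDiag_nonneg hab.le hcd.le p)]
    exact mul_le_mul_of_nonneg_left (norm_le_pi_norm s p) (gridDiag_nonneg hab.le hcd.le p)
  have h3 := mul_le_mul_of_nonneg_right (gridDiag_le hab hcd hγ hMx hMy p) (norm_nonneg s)
  refine (abs_sub _ _).trans ?_
  linarith

/-- Stability of the implicit part in the maximum norm. -/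
lemma norm_le_norm_implicit (hab : a < b) (hcd : c < d) (hγ₀ : 0 < γ) (hγ : γ < 1) (hMx : 1 ≤ Mx)
    (hMy : 1 ≤ My) {τ : ℝ} (hτ : 0 ≤ τ) (s : Grid Mx My → ℝ) :
    ‖s‖ ≤ ‖(1 + (τ / 2) • matA a b c d γ Mx My).mulVec s‖ := by
  have : Nonempty (Grid Mx My) := ⟨⟨⟨0, by omega⟩, ⟨0, by omega⟩⟩⟩
  -- At an index of largest modulus the off-diagonal sum is at most the diagonal entry times `|s
  -- p|`, so the contribution of `A` cannot decrease `|s p|`.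
  obtain ⟨p, hp⟩ := Finite.exists_max fun p => |s p|
  have hs : ‖s‖ ≤ |s p| := (pi_norm_le_iff_of_nonneg (abs_nonneg _)).2 hp
  refine le_trans ?_ (norm_le_pi_norm _ p)
  rw [Matrix.add_mulVec, Matrix.one_mulVec, Matrix.smul_mulVec, Pi.add_apply, Pi.smul_apply,
    matA_mulVec_apply, smul_eq_mul, Real.norm_eq_abs]
  have h1 := abs_sum_gridWeight_mul_le hab hcd hγ₀ hγ hMx hMy p s
  have hD := gridDiag_nonneg (γ := γ) hab.le hcd.le p
  set D := gridDiag a b c d γ Mx My p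
  set S := ∑ q, gridWeight a b c d γ Mx My p q * s q
  have hτ2 : 0 ≤ τ / 2 := by linarith
  have e : s p + τ / 2 * (D * s p - S) = (1 + τ / 2 * D) * s p - τ / 2 * S := by ring
  have h2 := abs_sub_abs_le_abs_sub ((1 + τ / 2 * D) * s p) (τ / 2 * S)
  rw [abs_mul, abs_mul, abs_of_nonneg hτ2, abs_of_nonneg (by positivity : 0 ≤ 1 + τ / 2 * D)] at h2
  rw [e]
  have h3 : τ / 2 * |S| ≤ τ / 2 * (D * |s p|) :=
    mul_le_mul_of_nonneg_left (h1.trans (mul_le_mul_of_nonneg_left hs hD)) hτ2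
  linarith

lemma implicit_bijective (hab : a < b) (hcd : c < d) (hγ₀ : 0 < γ) (hγ : γ < 1) (hMx : 1 ≤ Mx)
    (hMy : 1 ≤ My) {τ : ℝ} (hτ : 0 ≤ τ) :
    Function.Bijective (1 + (τ / 2) • matA a b c d γ Mx My).mulVec := by
  have hinj : Function.Injective (1 + (τ / 2) • matA a b c d γ Mx My).mulVecLin := by
    refine (injective_iff_map_eq_zero _).2 fun s hs => ?_
    have := norm_le_norm_implicit hab hcd hγ₀ hγ hMx hMy hτ s
    rw [Matrix.mulVecLin_apply] at hs
    rw [hs, norm_zero] at this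
    exact norm_le_zero_iff.1 this
  exact ⟨hinj, LinearMap.injective_iff_surjective.1 hinj⟩

theorem existsUnique_isSchemeSolution (hab : a < b) (hcd : c < d) (hγ₀ : 0 < γ) (hγ : γ < 1)
    (hMx : 1 ≤ Mx) (hMy : 1 ≤ My) {τ : ℝ} (hτ : 0 ≤ τ) (N : ℕ) (f g : ℝ → ℝ → ℝ → ℝ)
    (u₀ : ℝ → ℝ → ℝ) :
    ∃! U : Fin (N + 1) → Grid Mx My → ℝ, IsSchemeSolution a b c d γ τ Mx My N f g u₀ U := by
  obtain ⟨hinj, hsurj⟩ := implicit_bijective hab hcd hγ₀ hγ hMx hMy hτ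
  choose inv hinv using hsurj
  let rhs : ℕ → (Grid Mx My → ℝ) → Grid Mx My → ℝ := fun k s =>
    (1 - (τ / 2) • matA a b c d γ Mx My).mulVec s
      + τ • sample a b c d Mx My (fun x y => f x y (((k : ℝ) + 1 / 2) * τ))
      + τ • bdryVec a b c d γ Mx My (fun x y => g x y (((k : ℝ) + 1 / 2) * τ))
  let V : ℕ → Grid Mx My → ℝ := fun k =>
    Nat.rec (sample a b c d Mx My u₀) (fun k s => inv (rhs k s)) k
  refine ⟨fun k => V k, ⟨rfl, fun k => hinv (rhs k (V k))⟩, fun W hW => ?_⟩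
  funext k
  induction k using Fin.induction with
  | zero => exact hW.1
  | succ k ih =>
    refine hinj ((hW.2 k).trans ?_)
    rw [ih]
    exact (hinv (rhs k (V k))).symm

end Stability

/-! ### Consistency in space -/

/-- Interior and boundary contributions add up to the full tensor product quadrature sum. -/
lemma matA_mulVec_sample_sub_bdryVec {a b c d γ : ℝ} {Mx My : ℕ} (hMx : 1 ≤ Mx) (hMy : 1 ≤ My)
    (v : ℝ → ℝ → ℝ) (p : Grid Mx My) :
    (matA a b c d γ Mx My).mulVec (sample a b c d Mx My v) p - bdryVec a b c d γ Mx My v p =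
      gridDiag a b c d γ Mx My p * sample a b c d Mx My v p -
        ∑ l ∈ Finset.range (2 * Mx + 1), ∑ r ∈ Finset.range (2 * My + 1),
          weight a b γ Mx ((p.1 : ℕ) + 1) l * weight c d γ My ((p.2 : ℕ) + 1) r *
            v (node a (step a b Mx) ((l : ℝ) / 2)) (node c (step c d My) ((r : ℝ) / 2)) := by
  have hint : ∑ q, gridWeight a b c d γ Mx My p q * sample a b c d Mx My v q =
      ∑ l ∈ Finset.Icc 1 (2 * Mx - 1), ∑ r ∈ Finset.Icc 1 (2 * My - 1),
        weight a b γ Mx ((p.1 : ℕ) + 1) l * weight c d γ My ((p.2 : ℕ) + 1) r *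
          v (node a (step a b Mx) ((l : ℝ) / 2)) (node c (step c d My) ((r : ℝ) / 2)) := by
    rw [Fintype.sum_prod_type, ← sum_fin_succ_eq_sum_Icc]
    refine Finset.sum_congr rfl fun l _ => ?_
    rw [← sum_fin_succ_eq_sum_Icc]
    rfl
  have hIcc : Finset.Icc 0 (2 * My) = Finset.range (2 * My + 1) := by
    ext r; simp
  -- The full grid splits into the interior and four edges; in `bdryVec` the corners are counted
  -- with the edges `x = a` and `x = b` only.
  rw [matA_mulVec_apply, hint, sum_range_eq_add_sum_Icc_add _ hMx]
  simp only [bdryVec, hIcc, sum_range_eq_add_sum_Icc_add _ hMy, Finset.sum_add_distrib,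
    mul_add, Finset.mul_sum, mul_assoc]
  ring

/-- `bdryVec` evaluates its data at boundary nodes only, so the prescribed data can be exchanged for
the exact solution. -/
lemma bdryVec_congr {a b c d γ : ℝ} (hab : a < b) (hcd : c < d) {Mx My : ℕ} (hMx : 1 ≤ Mx)
    (hMy : 1 ≤ My) {g v : ℝ → ℝ → ℝ}
    (h : ∀ p ∈ (Icc a b ×ˢ Icc c d) \ (Ioo a b ×ˢ Ioo c d), v p.1 p.2 = g p.1 p.2) :
    bdryVec a b c d γ Mx My g = bdryVec a b c d γ Mx My v := by
  have hX0 : node a (step a b Mx) (((0 : ℕ) : ℝ) / 2) = a := by simp [node]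
  have hY0 : node c (step c d My) (((0 : ℕ) : ℝ) / 2) = c := by simp [node]
  have hX1 : node a (step a b Mx) (((2 * Mx : ℕ) : ℝ) / 2) = b := by
    push_cast
    rw [mul_div_cancel_left₀ _ two_ne_zero, node_step_last hMx]
  have hY1 : node c (step c d My) (((2 * My : ℕ) : ℝ) / 2) = d := by
    push_cast
    rw [mul_div_cancel_left₀ _ two_ne_zero, node_step_last hMy]
  have hl : ∀ y ∈ Icc c d, g a y = v a y := fun y hy =>
    (h (a, y) ⟨⟨⟨le_rfl, hab.le⟩, hy⟩, fun H => lt_irrefl _ H.1.1⟩).symm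
  have hr : ∀ y ∈ Icc c d, g b y = v b y := fun y hy =>
    (h (b, y) ⟨⟨⟨hab.le, le_rfl⟩, hy⟩, fun H => lt_irrefl _ H.1.2⟩).symm
  have hb : ∀ x ∈ Icc a b, g x c = v x c := fun x hx =>
    (h (x, c) ⟨⟨hx, ⟨le_rfl, hcd.le⟩⟩, fun H => lt_irrefl _ H.2.1⟩).symm
  have ht : ∀ x ∈ Icc a b, g x d = v x d := fun x hx =>
    (h (x, d) ⟨⟨hx, ⟨hcd.le, le_rfl⟩⟩, fun H => lt_irrefl _ H.2.2⟩).symm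
  have hYm : ∀ r ∈ Finset.Icc 0 (2 * My), node c (step c d My) ((r : ℝ) / 2) ∈ Icc c d :=
    fun r hr => node_mem_Icc hcd hMy (Finset.mem_Icc.1 hr).2
  have hXm : ∀ l ∈ Finset.Icc 1 (2 * Mx - 1), node a (step a b Mx) ((l : ℝ) / 2) ∈ Icc a b :=
    fun l hl => node_mem_Icc hab hMx (by have := (Finset.mem_Icc.1 hl).2; omega)
  funext p
  simp only [bdryVec, hX0, hX1, hY0, hY1]
  congr 1
  · congr 1
    · congr 1
      · congr 1
        exact Finset.sum_congr rfl fun r hr' => by rw [hl _ (hYm r hr')]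
      · congr 1
        exact Finset.sum_congr rfl fun r hr' => by rw [hr _ (hYm r hr')]
    · exact Finset.sum_congr rfl fun l hl' => by rw [hb _ (hXm l hl')]
  · exact Finset.sum_congr rfl fun l hmem => by rw [ht _ (hXm l hmem)]

/-- The consistency error of the space discretization. -/
theorem abs_space_error_le {a b c d γ B : ℝ} (hab : a < b) (hcd : c < d) (hγ₀ : 0 < γ)
    (hγ : γ < 1) {Mx My : ℕ} (hMx : 1 ≤ Mx) (hMy : 1 ≤ My) {v : ℝ → ℝ → ℝ}
    (hv : SlicesBounded a b c d B v) (p : Grid Mx My) :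
    |(matA a b c d γ Mx My).mulVec (sample a b c d Mx My v) p - bdryVec a b c d γ Mx My v p -
      sample a b c d Mx My (nonlocalOp a b c d γ v) p| ≤
      quadConst a b γ * B * step a b Mx ^ (4 - γ) * kernBound c d γ +
        kernBound a b γ * (quadConst c d γ * B * step c d My ^ (4 - γ)) := by
  have key := abs_tensor_quadrature_error_le hab hcd hγ₀ hγ hMx hMy (index_succ_le p.1)
    (index_succ_le p.2) hv
  rw [matA_mulVec_sample_sub_bdryVec hMx hMy]
  refine le_of_eq_of_le (congrArg abs ?_) key
  simp only [sample, gridDiag, diagWeight_eq, nonlocalOp_eq hγ hab.le hcd.le _ _ hv.continuousOn]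
  ring

/-! ### Consistency in time, Grönwall and the error recursion -/

/-- The midpoint difference quotient. -/
lemma abs_midpoint_deriv_le {z : ℝ → ℝ} {t τ z' B : ℝ} (hτ : 0 < τ)
    (hz : ContDiffOn ℝ 3 z (Icc t (t + τ)))
    (hB : ∀ s ∈ Icc t (t + τ), ∀ m ≤ 3, |iteratedDerivWithin m z (Icc t (t + τ)) s| ≤ B)
    (hz' : HasDerivWithinAt z z' (Icc t (t + τ)) (t + τ / 2)) :
    |z (t + τ) - z t - τ * z'| ≤ τ * (B * τ ^ 2) := by
  set I := Icc t (t + τ) with hI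
  have hU : UniqueDiffOn ℝ I := uniqueDiffOn_Icc (by linarith)
  have h0 : t ∈ I := ⟨le_rfl, by linarith⟩
  have hm : t + τ / 2 ∈ I := ⟨by linarith, by linarith⟩
  have h1 : t + τ ∈ I := ⟨by linarith, le_rfl⟩
  have hB0 : 0 ≤ B := (abs_nonneg _).trans (hB t h0 0 (by norm_num))
  -- `z (t + τ)` is expanded to second order and the derivative at the midpoint to first order, both
  -- about `t`; the terms in `D1` and `D2` then cancel.
  have k1 := taylor_mean_remainder_bound (n := 2) (C := B) (by linarith : t ≤ t + τ)
    (by exact_mod_cast hz) h1 (fun y hy => hB y hy 3 le_rfl)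
  have k2 := taylor_mean_remainder_bound (n := 1) (C := B) (f := derivWithin z I)
    (by linarith : t ≤ t + τ) (hz.derivWithin hU (by norm_num)) hm (fun y hy => by
      rw [← iteratedDerivWithin_succ']; exact hB y hy 3 le_rfl)
  rw [taylor_within_apply] at k1 k2
  simp only [Finset.sum_range_succ, Finset.sum_range_zero, smul_eq_mul, Nat.factorial, ← hI,
    ← iteratedDerivWithin_succ', iteratedDerivWithin_zero, Real.norm_eq_abs] at k1 k2
  rw [hz'.derivWithin (hU _ hm)] at k2
  simp only [zero_add, one_add_one_eq_two] at k2
  set D1 := iteratedDerivWithin 1 z I t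
  set D2 := iteratedDerivWithin 2 z I t
  norm_num at k1 k2
  have k3 : |τ * (z' - (D1 + τ / 2 * D2))| ≤ τ * (B * (τ / 2) ^ 2) := by
    rw [abs_mul, abs_of_pos hτ]
    exact mul_le_mul_of_nonneg_left k2 hτ.le
  have hnn : 0 ≤ τ * (B * τ ^ 2) := by positivity
  rw [abs_le] at k1 k3 ⊢
  constructor <;> nlinarith [k1.1, k1.2, k3.1, k3.2]

/-- The average of the end point values approximates the midpoint value. -/
lemma abs_midpoint_average_le {z : ℝ → ℝ} {t τ B : ℝ} (hτ : 0 < τ)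
    (hz : ContDiffOn ℝ 2 z (Icc t (t + τ)))
    (hB : ∀ s ∈ Icc t (t + τ), ∀ m ≤ 2, |iteratedDerivWithin m z (Icc t (t + τ)) s| ≤ B) :
    |(z (t + τ) + z t) / 2 - z (t + τ / 2)| ≤ B * τ ^ 2 := by
  have h0 : t ∈ Icc t (t + τ) := ⟨le_rfl, by linarith⟩
  have hm : t + τ / 2 ∈ Icc t (t + τ) := ⟨by linarith, by linarith⟩
  have h1 : t + τ ∈ Icc t (t + τ) := ⟨by linarith, le_rfl⟩
  have hB0 : 0 ≤ B := (abs_nonneg _).trans (hB t h0 0 (by norm_num))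
  have key := fun x hx => taylor_mean_remainder_bound (n := 1) (C := B) (x := x)
    (by linarith : t ≤ t + τ) (by exact_mod_cast hz) hx (fun y hy => hB y hy 2 le_rfl)
  have k1 := key _ h1
  have k2 := key _ hm
  rw [taylor_within_apply] at k1 k2
  simp only [Finset.sum_range_succ, Finset.sum_range_zero, smul_eq_mul, Nat.factorial,
    iteratedDerivWithin_zero, Real.norm_eq_abs] at k1 k2
  norm_num at k1 k2
  have hnn : 0 ≤ B * τ ^ 2 := by positivity
  rw [abs_le] at k1 k2 ⊢
  constructor <;> nlinarith [k1.1, k1.2, k2.1, k2.2]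

/-- A discrete Grönwall inequality. -/
lemma discrete_gronwall {N : ℕ} {e : Fin (N + 1) → ℝ} {K τ ρ T : ℝ} (hK : 0 ≤ K) (hτ : 0 ≤ τ)
    (hρ : 0 ≤ ρ) (hT : N * τ ≤ T) (h0 : e 0 ≤ 0)
    (hstep : ∀ k : Fin N, e k.succ ≤ (1 + τ * K) * e k.castSucc + τ * ρ) (k : Fin (N + 1)) :
    e k ≤ T * Real.exp (T * K) * ρ := by
  have h1 : 1 ≤ 1 + τ * K := by linarith [mul_nonneg hτ hK]
  -- A cruder majorant than the geometric sum, which avoids dividing by `K`.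
  have key : e k ≤ (k : ℕ) * τ * ρ * (1 + τ * K) ^ (k : ℕ) := by
    induction k using Fin.induction with
    | zero => simpa using h0
    | succ k ih =>
      simp only [Fin.val_castSucc, Fin.val_succ] at ih ⊢
      have h2 : 1 ≤ (1 + τ * K) ^ ((k : ℕ) + 1) := one_le_pow₀ h1
      calc e k.succ ≤ (1 + τ * K) * e k.castSucc + τ * ρ := hstep k
        _ ≤ (1 + τ * K) * ((k : ℕ) * τ * ρ * (1 + τ * K) ^ (k : ℕ)) +
            τ * ρ * (1 + τ * K) ^ ((k : ℕ) + 1) := by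
            refine add_le_add (mul_le_mul_of_nonneg_left ih (by linarith)) ?_
            exact le_mul_of_one_le_right (by positivity) h2
        _ = _ := by push_cast; ring
  have hk : ((k : ℕ) : ℝ) ≤ N := by exact_mod_cast Nat.le_of_lt_succ k.2
  have hkT : (k : ℕ) * τ ≤ T := (mul_le_mul_of_nonneg_right hk hτ).trans hT
  have hT0 : 0 ≤ T := (by positivity : (0 : ℝ) ≤ (k : ℕ) * τ).trans hkT
  have hexp : (1 + τ * K) ^ (k : ℕ) ≤ Real.exp (T * K) := by
    calc (1 + τ * K) ^ (k : ℕ) ≤ Real.exp (τ * K) ^ (k : ℕ) :=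
          pow_le_pow_left₀ (by linarith) (by linarith [Real.add_one_le_exp (τ * K)]) _
      _ = Real.exp ((k : ℕ) * τ * K) := by rw [← Real.exp_nat_mul]; ring_nf
      _ ≤ _ := Real.exp_le_exp.2 (mul_le_mul_of_nonneg_right hkT hK)
  calc e k ≤ (k : ℕ) * τ * ρ * (1 + τ * K) ^ (k : ℕ) := key
    _ ≤ T * ρ * Real.exp (T * K) := by gcongr
    _ = _ := by ring

/-- One step of the scheme, applied to the exact solution. -/
lemma error_step {ι : Type*} [Fintype ι] [DecidableEq ι] {A : Matrix ι ι ℝ} {τ K ρ₁ ρ₂ ρ₃ : ℝ}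
    (hτ : 0 < τ) (hstab : ∀ s, ‖s‖ ≤ ‖(1 + (τ / 2) • A).mulVec s‖)
    (hA : ∀ s, ‖A.mulVec s‖ ≤ 2 * K * ‖s‖) (hK : 0 ≤ K) {U₀ U₁ F G v₀ v₁ vm D L : ι → ℝ}
    (hU : (1 + (τ / 2) • A).mulVec U₁ = (1 - (τ / 2) • A).mulVec U₀ + τ • F + τ • G)
    (hF : F = D + L) (hρ₁ : 0 ≤ ρ₁) (hρ₂ : 0 ≤ ρ₂) (hρ₃ : 0 ≤ ρ₃)
    (h₁ : ∀ p, |v₁ p - v₀ p - τ * D p| ≤ τ * ρ₁)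
    (h₂ : ∀ p, |(v₁ p + v₀ p) / 2 - vm p| ≤ ρ₂)
    (h₃ : ∀ p, |A.mulVec vm p - G p - L p| ≤ ρ₃) :
    ‖v₁ - U₁‖ ≤ (1 + τ * K) * ‖v₀ - U₀‖ + τ * (ρ₁ + 2 * K * ρ₂ + ρ₃) := by
  -- The error equation. Its defects are the difference quotient, `A` applied to the average minus
  -- the midpoint value, and the spatial residual at the midpoint; `D` stands for the time
  -- derivative and `L` for the nonlocal term there.
  have e : (1 + (τ / 2) • A).mulVec (v₁ - U₁) =
      (v₀ - U₀) - (τ / 2) • A.mulVec (v₀ - U₀) + (v₁ - v₀ - τ • D) +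
        τ • A.mulVec ((1 / 2 : ℝ) • (v₁ + v₀) - vm) + τ • (A.mulVec vm - G - L) := by
    rw [Matrix.mulVec_sub, hU, hF]
    simp only [Matrix.add_mulVec, Matrix.sub_mulVec, Matrix.one_mulVec, Matrix.smul_mulVec,
      Matrix.mulVec_sub, Matrix.mulVec_smul, Matrix.mulVec_add]
    funext p
    simp only [Pi.add_apply, Pi.sub_apply, Pi.smul_apply, smul_eq_mul]
    ring
  have b1 : ‖v₁ - v₀ - τ • D‖ ≤ τ * ρ₁ :=
    (pi_norm_le_iff_of_nonneg (by positivity)).2 h₁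
  have b2 : ‖(1 / 2 : ℝ) • (v₁ + v₀) - vm‖ ≤ ρ₂ := by
    refine (pi_norm_le_iff_of_nonneg hρ₂).2 fun p => ?_
    rw [Real.norm_eq_abs]
    refine le_of_eq_of_le (congrArg abs ?_) (h₂ p)
    simp only [Pi.add_apply, Pi.sub_apply, Pi.smul_apply, smul_eq_mul]
    ring
  have b3 : ‖A.mulVec vm - G - L‖ ≤ ρ₃ := (pi_norm_le_iff_of_nonneg hρ₃).2 h₃
  have c0 : ‖(τ / 2) • A.mulVec (v₀ - U₀)‖ ≤ τ * K * ‖v₀ - U₀‖ := by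
    rw [norm_smul, Real.norm_eq_abs, abs_of_pos (half_pos hτ)]
    have := mul_le_mul_of_nonneg_left (hA (v₀ - U₀)) (half_pos hτ).le
    linarith
  have c2 : ‖τ • A.mulVec ((1 / 2 : ℝ) • (v₁ + v₀) - vm)‖ ≤ τ * (2 * K * ρ₂) := by
    rw [norm_smul, Real.norm_eq_abs, abs_of_pos hτ]
    exact mul_le_mul_of_nonneg_left
      ((hA _).trans (mul_le_mul_of_nonneg_left b2 (by positivity))) hτ.le
  have c3 : ‖τ • (A.mulVec vm - G - L)‖ ≤ τ * ρ₃ := by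
    rw [norm_smul, Real.norm_eq_abs, abs_of_pos hτ]
    exact mul_le_mul_of_nonneg_left b3 hτ.le
  refine (hstab _).trans ?_
  rw [e]
  refine (norm_add₄_le.trans (add_le_add_left (add_le_add_left (add_le_add_left
    (norm_sub_le _ _) _) _) _)).trans ?_
  linarith

lemma interior_node_mem_Ioo {a b : ℝ} (hab : a < b) {M : ℕ} (hM : 1 ≤ M) (i : Fin (2 * M - 1)) :
    node a (step a b M) ((((i : ℕ) + 1 : ℕ) : ℝ) / 2) ∈ Ioo a b := by
  have hh := step_pos hab hM
  have h1 : node a (step a b M) 0 = a := by simp [node]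
  have h2 : (((i : ℕ) + 1 : ℕ) : ℝ) < 2 * M := by
    have := i.2
    exact_mod_cast (by omega : (i : ℕ) + 1 < 2 * M)
  exact ⟨h1.symm.trans_lt ((node_lt_node hh a).2 (by positivity)),
    ((node_lt_node hh a).2 (by linarith)).trans_eq (node_step_last hM)⟩

end NonlocalCN

/-! ### Assembly of the error estimate -/

/-- The norm on `Grid Mx My → ℝ` is the maximum norm. -/
theorem theorem3p11 (a b c d T γ : ℝ) (hab : a < b) (hcd : c < d) (hT : 0 < T)
    (hγ₀ : 0 < γ) (hγ₁ : γ < 1)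
    (f g : ℝ → ℝ → ℝ → ℝ) (u₀ : ℝ → ℝ → ℝ) (u : ℝ → ℝ → ℝ → ℝ)
    (hsol : NonlocalCN.IsExactSolution a b c d T γ f g u₀ u)
    (hsmooth : NonlocalCN.IsSmooth a b c d T u) :
    ∃ C : ℝ, ∀ (Mx My N : ℕ) (τ : ℝ), 1 ≤ Mx → 1 ≤ My → 0 < τ → (N : ℝ) * τ ≤ T →
      (∃! U : Fin (N + 1) → NonlocalCN.Grid Mx My → ℝ,
        NonlocalCN.IsSchemeSolution a b c d γ τ Mx My N f g u₀ U) ∧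
      ∀ U : Fin (N + 1) → NonlocalCN.Grid Mx My → ℝ,
        NonlocalCN.IsSchemeSolution a b c d γ τ Mx My N f g u₀ U →
        ∀ k : Fin (N + 1),
          ‖NonlocalCN.sample a b c d Mx My (fun x y => u x y (((k : ℕ) : ℝ) * τ)) - U k‖ ≤
            C * (τ ^ 2 + NonlocalCN.step a b Mx ^ (4 - γ) + NonlocalCN.step c d My ^ (4 - γ)) := by
  open NonlocalCN in
  obtain ⟨hC6, ⟨Bs, hBs⟩, hC3, ⟨Bt, hBt⟩⟩ := hsmooth
  obtain ⟨hpde, hbd, hu₀⟩ := hsol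
  have hac : (a, c) ∈ Icc a b ×ˢ Icc c d := ⟨⟨le_rfl, hab.le⟩, ⟨le_rfl, hcd.le⟩⟩
  have hBs0 : 0 ≤ Bs := (norm_nonneg _).trans (hBs 0 ⟨le_rfl, hT.le⟩ _ hac 0 (by norm_num))
  have hBt0 : 0 ≤ Bt := (abs_nonneg _).trans (hBt _ hac 0 ⟨le_rfl, hT.le⟩ 0 (by norm_num))
  have hKx := kernBound_nonneg hab.le hγ₁
  have hKy := kernBound_nonneg hcd.le hγ₁
  have hQx := quadConst_nonneg hab.le hγ₁
  have hQy := quadConst_nonneg hcd.le hγ₁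
  set Kx := kernBound a b γ
  set Ky := kernBound c d γ
  set Qx := quadConst a b γ
  set Qy := quadConst c d γ
  have hK : 0 ≤ Kx * Ky := mul_nonneg hKx hKy
  -- The Grönwall factor times the sum of the coefficients of `τ ^ 2`, `h_x ^ (4 - γ)` and `h_y ^ (4
  -- - γ)` in the one-step defect.
  refine ⟨T * Real.exp (T * (Kx * Ky)) *
    (Bt + 2 * (Kx * Ky) * Bt + Qx * Bs * Ky + Kx * (Qy * Bs)), ?_⟩
  intro Mx My N τ hMx hMy hτ hN
  refine ⟨existsUnique_isSchemeSolution hab hcd hγ₀ hγ₁ hMx hMy hτ.le N f g u₀, ?_⟩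
  intro U hU k
  have hhx : 0 ≤ step a b Mx ^ (4 - γ) := Real.rpow_nonneg (step_pos hab hMx).le _
  have hhy : 0 ≤ step c d My ^ (4 - γ) := Real.rpow_nonneg (step_pos hcd hMy).le _
  set ρ₁ := Bt * τ ^ 2 with hρ₁
  set ρ₃ := Qx * Bs * step a b Mx ^ (4 - γ) * Ky + Kx * (Qy * Bs * step c d My ^ (4 - γ)) with hρ₃
  have hρ₁0 : 0 ≤ ρ₁ := by positivity
  have hρ₃0 : 0 ≤ ρ₃ := by positivity
  have hstep : ∀ k : Fin N,
      ‖sample a b c d Mx My (fun x y => u x y (((k.succ : ℕ) : ℝ) * τ)) - U k.succ‖ ≤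
        (1 + τ * (Kx * Ky)) *
          ‖sample a b c d Mx My (fun x y => u x y (((k.castSucc : ℕ) : ℝ) * τ)) - U k.castSucc‖ +
        τ * (ρ₁ + 2 * (Kx * Ky) * ρ₁ + ρ₃) := by
    intro k
    set t : ℝ := ((k : ℕ) : ℝ) * τ with ht
    have ht0 : 0 ≤ t := by positivity
    have htN : t + τ ≤ T := by
      have : (((k : ℕ) : ℝ) + 1) ≤ N := by exact_mod_cast k.2
      have := mul_le_mul_of_nonneg_right this hτ.le
      rw [ht]; linarith
    have htm : (((k : ℕ) : ℝ) + 1 / 2) * τ = t + τ / 2 := by rw [ht]; ring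
    have hts : ((k.succ : ℕ) : ℝ) * τ = t + τ := by
      rw [ht, Fin.val_succ]; push_cast; ring
    have htc : ((k.castSucc : ℕ) : ℝ) * τ = t := by rw [ht, Fin.val_castSucc]
    rw [hts, htc]
    -- The equation and the boundary condition are available only for positive times; the midpoint
    -- is positive even in the first step.
    have hm : t + τ / 2 ∈ Ioc 0 T := ⟨by linarith, by linarith⟩
    have hm' : t + τ / 2 ∈ Icc 0 T := ⟨hm.1.le, hm.2⟩
    have hsub : Icc t (t + τ) ⊆ Icc 0 T := Icc_subset_Icc ht0 htN
    have hstepU := hU.2 k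
    rw [htm] at hstepU
    have hslices : SlicesBounded a b c d Bs (fun x y => u x y (t + τ / 2)) :=
      slicesBounded_of_contDiffOn hab hcd ((hC6 _ hm').of_le (by norm_num))
        fun p hp m hm => hBs _ hm' p hp m (by omega)
    have htime : ∀ q : ℝ × ℝ, q ∈ Icc a b ×ˢ Icc c d →
        ∀ s ∈ Icc t (t + τ), ∀ m ≤ 3,
        |iteratedDerivWithin m (fun s => u q.1 q.2 s) (Icc t (t + τ)) s| ≤ Bt := by
      intro q hq s hs m hm
      rw [iteratedDerivWithin_Icc_subset (n := 3) (by linarith) hT hsub (hC3 q hq) hm hs]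
      exact hBt q hq s (hsub hs) m hm
    refine error_step hτ
      (norm_le_norm_implicit hab hcd hγ₀ hγ₁ hMx hMy hτ.le)
      (norm_matA_mulVec_le hab hcd hγ₀ hγ₁ hMx hMy) hK hstepU
      (vm := sample a b c d Mx My (fun x y => u x y (t + τ / 2)))
      (D := sample a b c d Mx My (fun x y => f x y (t + τ / 2) -
        nonlocalOp a b c d γ (fun x' y' => u x' y' (t + τ / 2)) x y))
      (L := sample a b c d Mx My (nonlocalOp a b c d γ (fun x' y' => u x' y' (t + τ / 2))))
      ?_ hρ₁0 hρ₁0 hρ₃0 (fun p => ?_) (fun p => ?_) (fun p => ?_)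
    · funext p
      simp [sample]
    · have hx := interior_node_mem_Ioo hab hMx p.1
      have hy := interior_node_mem_Ioo hcd hMy p.2
      have hq := mk_mem_prod (Ioo_subset_Icc_self hx) (Ioo_subset_Icc_self hy)
      exact abs_midpoint_deriv_le hτ ((hC3 _ hq).mono hsub) (htime _ hq)
        ((hpde _ hx _ hy _ hm).mono hsub)
    · have hx := interior_node_mem_Ioo hab hMx p.1
      have hy := interior_node_mem_Ioo hcd hMy p.2
      have hq := mk_mem_prod (Ioo_subset_Icc_self hx) (Ioo_subset_Icc_self hy)
      exact abs_midpoint_average_le hτ (((hC3 _ hq).mono hsub).of_le (by norm_num))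
        fun s hs m hm => htime _ hq s hs m (by omega)
    · rw [bdryVec_congr hab hcd hMx hMy (v := fun x y => u x y (t + τ / 2))
        fun q hq => hbd q hq _ hm]
      exact abs_space_error_le hab hcd hγ₀ hγ₁ hMx hMy hslices p
  have h0 : ‖sample a b c d Mx My (fun x y => u x y ((((0 : Fin (N + 1)) : ℕ) : ℝ) * τ)) - U 0‖
      ≤ 0 := by
    rw [hU.1, norm_le_zero_iff, sub_eq_zero]
    funext p
    simp only [sample, Fin.val_zero, Nat.cast_zero, zero_mul]
    exact hu₀ _ (interior_node_mem_Ioo hab hMx p.1) _ (interior_node_mem_Ioo hcd hMy p.2)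
  have hfin := discrete_gronwall
    (e := fun k : Fin (N + 1) =>
      ‖sample a b c d Mx My (fun x y => u x y (((k : ℕ) : ℝ) * τ)) - U k‖)
    hK hτ.le (by positivity) hN h0 hstep k
  refine hfin.trans ?_
  rw [mul_assoc (T * Real.exp (T * (Kx * Ky)))]
  refine mul_le_mul_of_nonneg_left ?_ (by positivity)
  -- The cross terms by which the product of the two sums exceeds the sum of the matching products.
  have n1 : 0 ≤ (Bt + 2 * (Kx * Ky) * Bt) * (step a b Mx ^ (4 - γ) + step c d My ^ (4 - γ)) := by
    positivity
  have n2 : 0 ≤ Qx * Bs * Ky * (τ ^ 2 + step c d My ^ (4 - γ)) := by positivity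
  have n3 : 0 ≤ Kx * (Qy * Bs) * (τ ^ 2 + step a b Mx ^ (4 - γ)) := by positivity
  rw [hρ₁, hρ₃]
  linarith
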